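/- Let $F$ be a non-archimedean local field of characteristic $0$ with ring of integers $\mathfrak o$, whose residue field has an even number of elements, and let $\mathrm{ord}$ be the normalized additive valuation of $F$ (so $\mathrm{ord}(0)=\infty$). Let $\mathcal H_n(\mathfrak o)$ be the set of half-integral matrices of degree $n$: symmetric matrices $B=(b_{ij})$ over $F$ with $b_{ii}\in\mathfrak o$ and $2b_{ij}\in\mathfrak o$ for $i\ne j$. Write $B\sim C$ if $C={}^tUBU$ for some $U\in GL_n(\mathfrak o)$, and let $B^{(k)}$ be the upper left $k\times k$ block of $B$. **Reduced forms.** Let $\underline a=(a_1\le\dots\le a_n)$ be a sequence of non-negative integers, let $m_1<\dots<m_r$ be its distinct values, $n_s$ the multiplicity of $m_s$, $n_s^*=n_1+\dots+n_s$ and $I_s=\{i: a_i=m_s\}$. For $\sigma\in\mathfrak S_n$ with $\sigma^2=1$ put $\mathcal P^0=\{i: \sigma(i)=i\}$, $\mathcal P^+=\{i: a_i>a_{\sigma(i)}\}$, $\mathcal P^-=\{i: a_i<a_{\sigma(i)}\}$. The involution $\sigma$ is $\underline a$-admissible if: (i) $\mathcal P^0$ has at most two elements; if it has two distinct elements $i,j$,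 then $a_i\not\equiv a_j \bmod 2$; and if $i\in I_s\cap\mathcal P^0$, then $i=\max I_s$ and $i=\max\{j\in\mathcal P^0\cup\mathcal P^+: a_j\equiv a_i \bmod 2\}$. (ii) Each $I_s\cap\mathcal P^-$ has at most one element; if $i\in I_s\cap\mathcal P^-$, then $i=\max I_s$ and $\sigma(i)=\min\{j\in\mathcal P^+: j>i,\ a_j\equiv a_i\bmod 2\}$. (iii) Each $I_s\cap\mathcal P^+$ has at most one element; if $i\in I_s\cap\mathcal P^+$, then $i=\min I_s$ and $\sigma(i)=\max\{j\in\mathcal P^-: j<i,\ a_j\equiv a_i\bmod 2\}$. (iv) If $a_i=a_{\sigma(i)}$, then $|i-\sigma(i)|\le1$. Let $\mathcal M(\underline a)$ (resp. $\mathcal M^0(\underline a)$) be the set of $B\in\mathcal H_n(\mathfrak o)$ with $\mathrm{ord}(b_{ii})\ge a_i$ for all $i$ and $\mathrm{ord}(2b_{ij})\ge(a_i+a_j)/2$ for $i<j$ (resp. the same with both inequalities strict). For $\sigma$ an $\underline a$-admissible involution, $B\in\mathcal M(\underline a)$ is a reduced form of GK-type $(\underline a,\sigma)$ if $\mathrm{ord}(2b_{i\sigma(i)})=(a_i+a_{\sigma(i)})/2$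 for $i\notin\mathcal P^0$, $\mathrm{ord}(b_{ii})=a_i$ for $i\in\mathcal P^0\cup\mathcal P^-$, and $\mathrm{ord}(2b_{ij})>(a_i+a_j)/2$ for $j\ne i,\sigma(i)$. **The extended GK datum.** For $B\in\mathcal H_n(\mathfrak o)$ with $\det B\ne0$ let $S(B)$ be the set of sequences $a_1\le\dots\le a_n$ of non-negative integers with $\mathrm{ord}(b_{ii})\ge a_i$ and $\mathrm{ord}(2b_{ij})\ge(a_i+a_j)/2$ for all $i,j$. The Gross–Keating invariant $\mathrm{GK}(B)$ is the lexicographically greatest element of $\bigcup_{C\sim B}S(C)$. The form $B$ is optimal if $\mathrm{GK}(B)\in S(B)$. Put $D_B=(-4)^{[n/2]}\det B$. For $n$ even let $\xi_B$ be $1$ if $D_B$ is a square in $F$, $-1$ if $F(\sqrt{D_B})/F$ is unramified quadratic, and $0$ if it is ramified quadratic. For $n$ odd let $\eta_B$ be the Clifford invariant of $B$: $\eta_B=1$ if the even Clifford algebra of the quadratic form $x\mapsto{}^txBx$ over $F$ is split (isomorphic to a matrix algebra over $F$), and $\eta_B=-1$ otherwise. With $n_s,n_s^*,m_s$ those of $\underline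 a=\mathrm{GK}(B)$, take an optimal $C\sim B$, let $\zeta_s$ be $\xi_{C^{(n_s^*)}}$ or $\eta_{C^{(n_s^*)}}$ according as $n_s^*$ is even or odd, and set $\mathrm{EGK}(B)=(n_1,\dots,n_r;m_1,\dots,m_r;\zeta_1,\dots,\zeta_r)$. **Theorem 3.3.** Let $B,B'\in\mathcal H_n(\mathfrak o)$, $n\ge0$. Assume that $B$ is a reduced form of GK-type $(\underline a,\sigma)$ and that $B'-B\in\mathcal M^0(\underline a)$. Then $B'$ is a reduced form of the same GK-type $(\underline a,\sigma)$. Moreover $\mathrm{EGK}(B)$ and $\mathrm{EGK}(B')$ are well defined (both matrices are non-degenerate, and the data do not depend on the chosen optimal forms) and $\mathrm{EGK}(B')=\mathrm{EGK}(B)$. -/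

import Mathlib

open ValuativeRel
open scoped Polynomial

namespace GrossKeating

noncomputable section

/-! ### The local field, half-integral matrices, equivalence -/

section LocalField

variable {F : Type*} [Field F] [ValuativeRel F] [TopologicalSpace F] [IsNonarchimedeanLocalField F]

open scoped Classical in
/-- The additive valuation `ord` of a non-archimedean local field, with values in `ℤ ∪ {∞}`,
normalized so that a prime element has order `1`; `ord 0 = ∞`. (An isomorphism of ordered monoids
from the value group with zero to `ℤᵐ⁰` is unique, whence the normalization.) -/
def ord (x : F) : WithTop ℤ :=
  if x = 0 then ⊤
  else ((-(WithZero.log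
    (IsNonarchimedeanLocalField.valueGroupWithZeroIsoInt F (valuation F x))) : ℤ) : WithTop ℤ)

/-- `B` is a half-integral symmetric matrix over the ring of integers `𝒪[F]`. -/
def IsHalfIntegral {ι : Type*} (B : Matrix ι ι F) : Prop :=
  B.IsSymm ∧ (∀ i, B i i ∈ 𝒪[F]) ∧ ∀ i j, i ≠ j → 2 * B i j ∈ 𝒪[F]

/-- `GL_n(𝒪)`-equivalence: `B' = ᵗU B U` for some `U ∈ GL_n(𝒪)`. -/
def IsEquivalent {n : ℕ} (B B' : Matrix (Fin n) (Fin n) F) : Prop :=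
  ∃ U : GL (Fin n) 𝒪[F],
    B' = ((U : Matrix (Fin n) (Fin n) 𝒪[F]).map (algebraMap 𝒪[F] F)).transpose * B *
      (U : Matrix (Fin n) (Fin n) 𝒪[F]).map (algebraMap 𝒪[F] F)

/-- The set `M(a)`: half-integral matrices with `ord (b_ii) ≥ a_i` and
`ord (2 b_ij) ≥ (a_i + a_j) / 2` for `i < j`. -/
def MSet {n : ℕ} (a : Fin n → ℕ) : Set (Matrix (Fin n) (Fin n) F) :=
  {B | IsHalfIntegral B ∧ (∀ i, (a i : WithTop ℤ) ≤ ord (B i i)) ∧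
    ∀ i j, i < j → ((a i + a j : ℕ) : WithTop ℤ) ≤ 2 • ord (2 * B i j)}

/-- The set `M⁰(a)`: half-integral matrices with `ord (b_ii) > a_i` and
`ord (2 b_ij) > (a_i + a_j) / 2` for `i < j`. -/
def MZeroSet {n : ℕ} (a : Fin n → ℕ) : Set (Matrix (Fin n) (Fin n) F) :=
  {B | IsHalfIntegral B ∧ (∀ i, (a i : WithTop ℤ) < ord (B i i)) ∧
    ∀ i j, i < j → ((a i + a j : ℕ) : WithTop ℤ) < 2 • ord (2 * B i j)}

/-! ### The Gross-Keating invariant and optimal forms -/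

/-- The set `S(B)` of non-decreasing sequences `a` of non-negative integers with
`ord (b_ii) ≥ a_i` and `ord (2 b_ij) ≥ (a_i + a_j) / 2` for all `i, j`. -/
def SSet {n : ℕ} (B : Matrix (Fin n) (Fin n) F) : Set (Fin n → ℕ) :=
  {a | Monotone a ∧ (∀ i, (a i : WithTop ℤ) ≤ ord (B i i)) ∧
    ∀ i j, ((a i + a j : ℕ) : WithTop ℤ) ≤ 2 • ord (2 * B i j)}

/-- The set `S({B})`, the union of the `S(B')` over all `B'` equivalent to `B`. -/
def SClassSet {n : ℕ} (B : Matrix (Fin n) (Fin n) F) : Set (Fin n → ℕ) :=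
  {a | ∃ B', IsEquivalent B B' ∧ a ∈ SSet B'}

/-- `GK(B) = a`: the half-integral matrix `B` is non-degenerate and `a` is the greatest element of
`S({B})` for the lexicographic order. -/
def HasGK {n : ℕ} (B : Matrix (Fin n) (Fin n) F) (a : Fin n → ℕ) : Prop :=
  IsHalfIntegral B ∧ B.det ≠ 0 ∧ a ∈ SClassSet B ∧ ∀ a' ∈ SClassSet B, toLex a' ≤ toLex a

/-- `B` is an optimal form: `GK(B) ∈ S(B)`. -/
def IsOptimal {n : ℕ} (B : Matrix (Fin n) (Fin n) F) : Prop :=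
  ∃ a, HasGK B a ∧ a ∈ SSet B

/-! ### The invariants `ξ` and `η` -/

/-- `D_B = (-4)^[n/2] det B`. -/
def disc {ι : Type*} [Fintype ι] [DecidableEq ι] (B : Matrix ι ι F) : F :=
  (-4) ^ (Fintype.card ι / 2) * B.det

/-- `F(√D) / F` is an unramified extension. Here `F(√D)` is the splitting field of `X² - D`, and
its ring of integers is the integral closure of `𝒪[F]`. -/
def IsUnramifiedSqrt (D : F) : Prop :=
  Algebra.FormallyUnramified 𝒪[F]
    (integralClosure 𝒪[F] (Polynomial.SplittingField (Polynomial.X ^ 2 - Polynomial.C D)))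

open scoped Classical in
/-- The invariant `ξ_B` of a non-degenerate `B` (used for even degree): `1` if `D_B` is a square,
`-1` if `F(√D_B) / F` is unramified quadratic, `0` if it is ramified quadratic. -/
def xi {ι : Type*} [Fintype ι] [DecidableEq ι] (B : Matrix ι ι F) : SignType :=
  if IsSquare (disc B) then 1 else if IsUnramifiedSqrt (disc B) then -1 else 0

end LocalField

/-- An algebra over a field `F` is split if it is isomorphic to a matrix algebra over `F`. -/
def IsSplitAlgebra (F A : Type*) [Field F] [Ring A] [Algebra F A] : Prop :=
  ∃ k : ℕ, Nonempty (A ≃ₐ[F] Matrix (Fin k) (Fin k) F)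

open scoped Classical in
/-- The Clifford invariant `η_B` of a non-degenerate `B`: the class in `{±1}` (the `2`-torsion of
the Brauer group of the local field `F`) of the Clifford algebra of the quadratic form
`x ↦ ᵗx B x` if the degree is even, and of its even Clifford algebra if the degree is odd. -/
def eta {F : Type*} [Field F] {ι : Type*} [Fintype ι] [DecidableEq ι] (B : Matrix ι ι F) :
    SignType :=
  if Even (Fintype.card ι) then
    if IsSplitAlgebra F (CliffordAlgebra B.toQuadraticForm') then 1 else -1
  else
    if IsSplitAlgebra F (CliffordAlgebra.even B.toQuadraticForm') then 1 else -1

/-- The upper left `k × k` block `B^(k)`. -/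
def upperLeft {R : Type*} {n : ℕ} (B : Matrix (Fin n) (Fin n) R) (k : ℕ) :
    Matrix {i : Fin n // (i : ℕ) < k} {i : Fin n // (i : ℕ) < k} R :=
  B.submatrix Subtype.val Subtype.val

/-! ### The extended GK datum -/

/-- A tuple `(n_1, …, n_r; m_1, …, m_r; ζ_1, …, ζ_r)` with `ζ_s ∈ {0, 1, -1}`. -/
structure Datum where
  r : ℕ
  mult : Fin r → ℕ
  m : Fin r → ℕ
  zeta : Fin r → SignType

/-- For a sequence `a` write `m_1 < ⋯ < m_r` for its distinct values. -/
def value {n : ℕ} (a : Fin n → ℕ) (s : Fin (Finset.univ.image a).card) : ℕ :=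
  (Finset.univ.image a).orderEmbOfFin rfl s

/-- The multiplicity `n_s` of the value `m_s` in `a`. -/
def multiplicity {n : ℕ} (a : Fin n → ℕ) (s : Fin (Finset.univ.image a).card) : ℕ :=
  (Finset.univ.filter fun i => a i = value a s).card

/-- The partial sum `n_s^* = n_1 + ⋯ + n_s`. -/
def partialSum {n : ℕ} (a : Fin n → ℕ) (s : Fin (Finset.univ.image a).card) : ℕ :=
  ∑ u ∈ Finset.Iic s, multiplicity a u

section EGK

variable {F : Type*} [Field F] [ValuativeRel F] [TopologicalSpace F] [IsNonarchimedeanLocalField F]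

/-- The datum `(n_1, …, n_r; m_1, …, m_r; ζ_1(C), …, ζ_r(C))` computed from a matrix `C` with
`GK(C) = a`, where `ζ_s(C)` is `ξ` or `η` of the block `C^(n_s^*)` according as `n_s^*` is even or
odd. -/
def datumOf {n : ℕ} (a : Fin n → ℕ) (C : Matrix (Fin n) (Fin n) F) : Datum where
  r := (Finset.univ.image a).card
  mult := multiplicity a
  m := value a
  zeta := fun s =>
    if Even (partialSum a s) then xi (upperLeft C (partialSum a s))
    else eta (upperLeft C (partialSum a s))

/-- The set of all values that the recipe for the extended GK datum of a non-degenerate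
half-integral matrix `B` produces: take `a = GK(B)`, take an optimal decomposition `C` of `B` (an
optimal form equivalent to `B`), and form the datum of `C`. That `EGK(B)` is well defined and equal
to `G` means that this set is `{G}`. -/
def EGKSet {n : ℕ} (B : Matrix (Fin n) (Fin n) F) : Set Datum :=
  {G | ∃ (a : Fin n → ℕ) (C : Matrix (Fin n) (Fin n) F),
    HasGK B a ∧ IsEquivalent B C ∧ IsOptimal C ∧ G = datumOf a C}

end EGK

/-! ### Admissible involutions and reduced forms -/

section Admissible

variable {n : ℕ}

/-- The set `P⁰(σ)` of fixed points. -/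
def PZero (σ : Equiv.Perm (Fin n)) : Set (Fin n) := {i | i = σ i}

/-- The set `P⁺(σ)`. -/
def PPlus (a : Fin n → ℕ) (σ : Equiv.Perm (Fin n)) : Set (Fin n) := {i | a (σ i) < a i}

/-- The set `P⁻(σ)`. -/
def PMinus (a : Fin n → ℕ) (σ : Equiv.Perm (Fin n)) : Set (Fin n) := {i | a i < a (σ i)}

/-- `σ` is an `a`-admissible involution (for a non-decreasing sequence `a`). The blocks `I_s` are
the level sets of `a`: `i` and `j` lie in the same block if and only if `a i = a j`. -/
structure IsAdmissible (a : Fin n → ℕ) (σ : Equiv.Perm (Fin n)) : Prop where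
  involutive : σ * σ = 1
  zero_card : (PZero σ).ncard ≤ 2
  zero_parity : ∀ i ∈ PZero σ, ∀ j ∈ PZero σ, i ≠ j → ¬ a i ≡ a j [MOD 2]
  zero_max : ∀ i ∈ PZero σ, IsGreatest {j | a j = a i} i
  zero_greatest : ∀ i ∈ PZero σ, IsGreatest {j | j ∈ PZero σ ∪ PPlus a σ ∧ a j ≡ a i [MOD 2]} i
  minus_unique : ∀ i ∈ PMinus a σ, ∀ j ∈ PMinus a σ, a i = a j → i = j
  minus_max : ∀ i ∈ PMinus a σ, IsGreatest {j | a j = a i} i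
  minus_least : ∀ i ∈ PMinus a σ, IsLeast {j | j ∈ PPlus a σ ∧ i < j ∧ a j ≡ a i [MOD 2]} (σ i)
  plus_unique : ∀ i ∈ PPlus a σ, ∀ j ∈ PPlus a σ, a i = a j → i = j
  plus_min : ∀ i ∈ PPlus a σ, IsLeast {j | a j = a i} i
  plus_greatest : ∀ i ∈ PPlus a σ,
    IsGreatest {j | j ∈ PMinus a σ ∧ j < i ∧ a j ≡ a i [MOD 2]} (σ i)
  adjacent : ∀ i, a i = a (σ i) → |((i : ℕ) : ℤ) - ((σ i : ℕ) : ℤ)| ≤ 1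

/-- `B` is a reduced form with GK-type `(a, σ)`, where `a` is a non-decreasing sequence of
non-negative integers and `σ` is an `a`-admissible involution. -/
structure IsReducedForm {F : Type*} [Field F] [ValuativeRel F] [TopologicalSpace F]
    [IsNonarchimedeanLocalField F] (a : Fin n → ℕ) (σ : Equiv.Perm (Fin n))
    (B : Matrix (Fin n) (Fin n) F) : Prop where
  monotone : Monotone a
  admissible : IsAdmissible a σ
  mem : B ∈ MSet a
  ord_pair : ∀ i, i ∉ PZero σ → 2 • ord (2 * B i (σ i)) = ((a i + a (σ i) : ℕ) : WithTop ℤ)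
  ord_diag : ∀ i ∈ PZero σ ∪ PMinus a σ, ord (B i i) = (a i : WithTop ℤ)
  ord_other : ∀ i j, j ≠ i → j ≠ σ i →
    ((a i + a j : ℕ) : WithTop ℤ) < 2 • ord (2 * B i j)

end Admissible

end

end GrossKeating

/-!
Let `B` be a reduced form of type `(a, σ)`, and read `ord (b_ii) ≥ a_i` and
`ord (2 b_ij) ≥ (a_i + a_j) / 2` as the statement that the quadratic form and its polarization are
bounded by the norm `‖x‖ = max |x_i| (1/2)^(a_i)` on `F^n`, where `|x| = 4 ^ (-ord x)`. Reducedness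
says which of these bounds are attained, and a perturbation by an element of `M⁰(a)` is invisible at
this precision. So `B'` is a reduced form of the same type (`IsReducedForm.of_sub_mem`), and the
content is that the extended GK datum only depends on what is visible.

**The Gross-Keating invariant is `a`.** Let `C = ᵗU B U` with `U` in `GL_n(𝒪)` and `a' ∈ S(C)`. By
induction on `c`, as long as `a` and `a'` truncated at `c` agree, the columns of `U` satisfy the
bounds `a'` for the norm above, truncated at level `c` (`IsReducedForm.nrm_le_of_min_eq`). In the
inductive step `IsReducedForm.nrm_le_succ`, consider the coordinates at which a column violates the
bound at level `c + 1`. Their values `a_i` have a common parity. If such an index is paired with one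
of value at most `c`, the pairing of the column with that basis vector is too large. By admissibility
at most one index of this parity is not (`IsAdmissible.eq_of_unpaired`), and then the value of the
quadratic form at the column is too large. Comparing
determinants, `a'` cannot exceed `a` lexicographically (`IsReducedForm.toLex_le`). If `a' = a`, then
`U⁻¹` is bounded for the norm (`IsReducedForm.nrm_inv_le`): all optimal forms equivalent to `B` come
from bases adapted to one norm.

**Blocks.** The upper left block of `B` of size `n_s^*` consists of the indices with `a_i ≤ m_s`. It
is again reduced in a weak sense (`QuasiReduced`), for the involution in which indices with a
partner outside the block become fixed. The values `a_i` of distinct fixed indices have different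
parity, so there are at most two of them, and the block is non-degenerate. For an optimal `C` equivalent to
`B`, the block of `U⁻¹` carries that of `C` to that of `B` up to a strictly bounded error
(`WeaklyBounded.strictlyBounded_block`). Both the independence of the optimal form and the equality
of the data of `B` and `B'` thus reduce to one statement: `ξ` (in even degree) and `η` (in odd
degree) of a quasi-reduced matrix do not change under strictly bounded perturbations
(`QuasiReduced.invariants_eq`).

**Invariance.** Split off the binary blocks of the pairs `{i, σ i}`; the Schur complement remains
quasi-reduced and changes by strictly bounded terms. By Hensel's lemma a binary block and its
perturbation have discriminants that agree up to a square and represent a common value up to any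
prescribed unit, so they are similar with any unit as factor. If at most one index is fixed, the
whole matrix is therefore similar to its perturbation (`QuasiReduced.exists_isSimilar`), and a
similitude preserves `η` in odd degree, because it induces an isomorphism of even Clifford algebras,
and `ξ` in even degree, because it changes the discriminant by a square. If two indices are fixed,
the discriminant is, up to squares, that of an Eisenstein polynomial
(`QuasiReduced.isEisensteinDisc`), so `F(√D)` is ramified and `ξ = 0` on both sides
(`IsEisensteinDisc.xi_eq_zero`).
-/

open scoped NNReal

namespace GrossKeating

noncomputable section

/-! ### The real-valued absolute value -/

section AbsoluteValue

variable {F : Type*} [Field F] [ValuativeRel F] [TopologicalSpace F] [IsNonarchimedeanLocalField F]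

variable (F) in
/-- The absolute value `x ↦ 4 ^ (-ord x)` of a local field. The base `4` makes
`ord (2 b_ij) ≥ (a_i + a_j) / 2` the inequality `nrm (2 b_ij) ≤ (1/2) ^ a_i * (1/2) ^ a_j`, in
which no half-integral exponent occurs. -/
def nrm : Valuation F ℝ≥0 :=
  (valuation F).map
    ((WithZeroMulInt.toNNReal (four_ne_zero : (4 : ℝ≥0) ≠ 0)).comp
      { toFun := IsNonarchimedeanLocalField.valueGroupWithZeroIsoInt F
        map_zero' := map_zero _
        map_one' := map_one _
        map_mul' := map_mul _ })
    ((WithZeroMulInt.toNNReal_strictMono (by norm_num : (1 : ℝ≥0) < 4)).monotone.comp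
      (IsNonarchimedeanLocalField.valueGroupWithZeroIsoInt F).strictMono.monotone)

lemma nrm_def (x : F) : nrm F x = WithZeroMulInt.toNNReal (four_ne_zero : (4 : ℝ≥0) ≠ 0)
    (IsNonarchimedeanLocalField.valueGroupWithZeroIsoInt F (valuation F x)) := rfl

lemma ord_zero : ord (0 : F) = ⊤ := by simp [ord]

lemma exists_ord_eq {x : F} (hx : x ≠ 0) :
    ∃ z : ℤ, ord x = z ∧ nrm F x = (1 / 4) ^ z := by
  have h0 : (IsNonarchimedeanLocalField.valueGroupWithZeroIsoInt F (valuation F x)) ≠ 0 := by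
    simpa using hx
  refine ⟨-(WithZero.log
    (IsNonarchimedeanLocalField.valueGroupWithZeroIsoInt F (valuation F x))), by simp [ord, hx], ?_⟩
  rw [nrm_def, WithZeroMulInt.toNNReal_neg_apply _ h0]
  rw [one_div, inv_zpow, zpow_neg, inv_inv]
  congr 1
  conv_rhs => rw [← WithZero.coe_unzero h0]
  rfl

lemma quarter_zpow (z : ℤ) : (1 / 4 : ℝ≥0) ^ z = (1 / 2) ^ (2 * z) := by
  rw [zpow_mul]; congr 1; rw [zpow_two]; norm_num

lemma exists_nrm_eq {x : F} (hx : x ≠ 0) : ∃ z : ℤ, nrm F x = (1 / 2) ^ (2 * z) := by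
  obtain ⟨z, -, h⟩ := exists_ord_eq hx
  exact ⟨z, by rw [h, quarter_zpow]⟩

lemma half_zpow_le {m n : ℤ} : (1 / 2 : ℝ≥0) ^ m ≤ (1 / 2) ^ n ↔ n ≤ m :=
  zpow_le_zpow_iff_right_of_lt_one₀ (by norm_num) (by
    rw [← NNReal.coe_lt_coe]; norm_num)

lemma half_zpow_lt {m n : ℤ} : (1 / 2 : ℝ≥0) ^ m < (1 / 2) ^ n ↔ n < m :=
  zpow_lt_zpow_iff_right_of_lt_one₀ (by norm_num) (by
    rw [← NNReal.coe_lt_coe]; norm_num)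

lemma half_zpow_inj {m n : ℤ} : (1 / 2 : ℝ≥0) ^ m = (1 / 2) ^ n ↔ n = m := by
  simp only [le_antisymm_iff, half_zpow_le]

lemma half_pow_le {m n : ℕ} : (1 / 2 : ℝ≥0) ^ m ≤ (1 / 2) ^ n ↔ n ≤ m := by
  simpa using half_zpow_le (m := m) (n := n)

lemma half_pow_lt {m n : ℕ} : (1 / 2 : ℝ≥0) ^ m < (1 / 2) ^ n ↔ n < m := by
  simpa using half_zpow_lt (m := m) (n := n)

lemma le_two_ord (m : ℕ) (x : F) : (m : WithTop ℤ) ≤ 2 • ord x ↔ nrm F x ≤ (1 / 2) ^ m := by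
  by_cases hx : x = 0
  · simp [hx, ord_zero, two_nsmul]
  · obtain ⟨z, h1, h2⟩ := exists_ord_eq hx
    rw [h1, h2, quarter_zpow, ← zpow_natCast, half_zpow_le, two_nsmul, two_mul]
    exact_mod_cast Iff.rfl

lemma lt_two_ord (m : ℕ) (x : F) : (m : WithTop ℤ) < 2 • ord x ↔ nrm F x < (1 / 2) ^ m := by
  by_cases hx : x = 0
  · simp [hx, ord_zero, two_nsmul]
  · obtain ⟨z, h1, h2⟩ := exists_ord_eq hx
    rw [h1, h2, quarter_zpow, ← zpow_natCast, half_zpow_lt, two_nsmul, two_mul]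
    exact_mod_cast Iff.rfl

lemma two_ord_eq (m : ℕ) (x : F) : 2 • ord x = (m : WithTop ℤ) ↔ nrm F x = (1 / 2) ^ m := by
  have h1 := le_two_ord m x
  have h2 := lt_two_ord m x
  rw [eq_comm, eq_iff_le_not_lt, eq_iff_le_not_lt, h1, h2]

lemma le_ord (m : ℕ) (x : F) : (m : WithTop ℤ) ≤ ord x ↔ nrm F x ≤ ((1 / 2) ^ m) ^ 2 := by
  by_cases hx : x = 0
  · simp [hx, ord_zero]
  · obtain ⟨z, h1, h2⟩ := exists_ord_eq hx
    rw [h1, h2, quarter_zpow, ← pow_mul, ← zpow_natCast, half_zpow_le]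
    push_cast
    have : ((m : ℕ) : WithTop ℤ) ≤ ((z : ℤ) : WithTop ℤ) ↔ (m : ℤ) ≤ z := by exact_mod_cast Iff.rfl
    rw [this]
    lia

lemma lt_ord (m : ℕ) (x : F) : (m : WithTop ℤ) < ord x ↔ nrm F x < ((1 / 2) ^ m) ^ 2 := by
  by_cases hx : x = 0
  · simp [hx, ord_zero]
  · obtain ⟨z, h1, h2⟩ := exists_ord_eq hx
    rw [h1, h2, quarter_zpow, ← pow_mul, ← zpow_natCast, half_zpow_lt]
    push_cast
    have : ((m : ℕ) : WithTop ℤ) < ((z : ℤ) : WithTop ℤ) ↔ (m : ℤ) < z := by exact_mod_cast Iff.rfl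
    rw [this]
    lia

lemma ord_eq (m : ℕ) (x : F) : ord x = (m : WithTop ℤ) ↔ nrm F x = ((1 / 2) ^ m) ^ 2 := by
  rw [eq_comm, eq_iff_le_not_lt, eq_iff_le_not_lt, le_ord, lt_ord]

lemma mem_integer_iff (x : F) : x ∈ 𝒪[F] ↔ nrm F x ≤ 1 := by
  rw [nrm_def, WithZeroMulInt.toNNReal_le_one_iff (by norm_num)]
  rw [← map_one (IsNonarchimedeanLocalField.valueGroupWithZeroIsoInt F),
    (IsNonarchimedeanLocalField.valueGroupWithZeroIsoInt F).strictMono.le_iff_le]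
  rfl

lemma nrm_integer_le (x : 𝒪[F]) : nrm F (x : F) ≤ 1 := (mem_integer_iff _).1 x.2

lemma isUnit_integer_iff (x : 𝒪[F]) : IsUnit x ↔ nrm F (x : F) = 1 := by
  constructor
  · rintro ⟨u, rfl⟩
    refine le_antisymm (nrm_integer_le _) ?_
    have h : nrm F ((u : 𝒪[F]) : F) * nrm F (((u⁻¹ : 𝒪[F]ˣ) : 𝒪[F]) : F) = 1 := by
      rw [← map_mul, ← Subring.coe_mul, Units.mul_inv]; simp
    calc 1 = _ := h.symm
      _ ≤ nrm F ((u : 𝒪[F]) : F) * 1 := by gcongr; exact nrm_integer_le _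
      _ = _ := mul_one _
  · intro h
    have hx : (x : F) ≠ 0 := by
      rintro h0; rw [h0] at h; simp at h
    refine IsUnit.of_mul_eq_one ⟨(x : F)⁻¹, (mem_integer_iff _).2 (by rw [map_inv₀, h, inv_one])⟩ ?_
    exact Subtype.ext (mul_inv_cancel₀ hx)

lemma mem_maximalIdeal_iff (x : 𝒪[F]) : x ∈ 𝓂[F] ↔ nrm F (x : F) < 1 := by
  rw [IsLocalRing.mem_maximalIdeal, mem_nonunits_iff, isUnit_integer_iff]
  exact ⟨fun h => lt_of_le_of_ne (nrm_integer_le x) h, fun h => h.ne⟩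

/-- The solvable case of Hensel's lemma: `1 / τ` is the root of `X² - X - g` congruent to `1`. -/
lemma exists_add_mul_sq_eq_one {g : F} (hg : nrm F g < 1) :
    ∃ τ : F, nrm F τ ≤ 1 ∧ τ + g * τ ^ 2 = 1 := by
  let := IsTopologicalAddGroup.rightUniformSpace F
  have := isUniformAddGroup_of_addCommGroup (G := F)
  let G : 𝒪[F] := ⟨g, (mem_integer_iff g).2 hg.le⟩
  let f : 𝒪[F][X] := Polynomial.X ^ 2 - Polynomial.X - Polynomial.C G
  have hf : f.Monic := by
    simp only [f]
    monicity!
  obtain ⟨t, ht, ht1⟩ := HenselianRing.is_henselian (I := 𝓂[F]) f hf 1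
    (by simp only [f, Polynomial.eval_sub, Polynomial.eval_pow, Polynomial.eval_X,
          Polynomial.eval_C, one_pow, sub_self, zero_sub, neg_mem_iff]
        exact (mem_maximalIdeal_iff _).2 hg)
    (by
      have : f.derivative.eval 1 = 1 := by
        simp only [f, Polynomial.derivative_sub, Polynomial.derivative_pow,
          Polynomial.derivative_X, Polynomial.derivative_C, Polynomial.eval_sub,
          Polynomial.eval_mul, Polynomial.eval_pow, Polynomial.eval_X, Polynomial.eval_C,
          Polynomial.eval_one, Polynomial.eval_zero]
        norm_num
      rw [this, map_one]; exact isUnit_one)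
  have hu : nrm F (t : F) = 1 := by
    have h := (mem_maximalIdeal_iff _).1 ht1
    have : (t : F) = 1 + ((t - 1 : 𝒪[F]) : F) := by push_cast; ring
    rw [this]
    refine Valuation.map_one_add_of_lt _ h
  have h0 : (t : F) ≠ 0 := by rintro h; rw [h] at hu; simp at hu
  refine ⟨(t : F)⁻¹, by rw [map_inv₀, hu, inv_one], ?_⟩
  have h2 : (t : F) ^ 2 - t - g = 0 := by
    have := congrArg (Subtype.val) ht
    simpa [f, G] using this
  field_simp
  linear_combination -h2

/-- `1 + 4y` is a square as soon as `y` lies in the maximal ideal. -/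
lemma exists_sq_eq_one_add_four_mul {y : F} (hy : nrm F y < 1) : ∃ c : F, c ^ 2 = 1 + 4 * y := by
  obtain ⟨τ, -, h⟩ := exists_add_mul_sq_eq_one hy
  exact ⟨1 + 2 * (y * τ), by linear_combination 4 * y * h⟩

/-- Discreteness of the value group: no absolute value lies strictly between `1 / 4` and `1`. -/
lemma nrm_lt_one_le {x : F} (h : nrm F x < 1) : nrm F x ≤ 1 / 4 := by
  by_cases hx : x = 0
  · simp [hx]
  obtain ⟨z, hz⟩ := exists_nrm_eq hx
  have h1 : (1 : ℝ≥0) = (1 / 2) ^ (0 : ℤ) := by simp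
  have h2 : (1 / 4 : ℝ≥0) = (1 / 2) ^ (2 : ℤ) := by rw [zpow_two]; norm_num
  replace h := h.trans_eq h1
  rw [hz, half_zpow_lt] at h
  rw [hz, h2, half_zpow_le]
  lia

variable (F) in
lemma exists_nrm_eq_quarter_zpow (z : ℤ) : ∃ x : F, x ≠ 0 ∧ nrm F x = (1 / 4) ^ z := by
  let e := IsNonarchimedeanLocalField.valueGroupWithZeroIsoInt F
  obtain ⟨x, hx⟩ := ValuativeRel.valuation_surjective (e.symm (WithZero.exp (-z)))
  have h0 : x ≠ 0 := by
    rintro rfl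
    rw [map_zero, eq_comm] at hx
    simp at hx
  refine ⟨x, h0, ?_⟩
  obtain ⟨w, h1, h2⟩ := exists_ord_eq h0
  rw [h2]
  congr 1
  simp only [ord, if_neg h0] at h1
  rw [hx] at h1
  have : ((-(-z) : ℤ) : WithTop ℤ) = w := by
    rw [← h1]; congr 2; simp [e]
  have := WithTop.coe_injective this
  lia

lemma nrm_two_lt_one (hq : Even (Nat.card 𝓀[F])) : nrm F 2 < 1 := by
  have : Fintype 𝓀[F] := Fintype.ofFinite _
  have h2 : ringChar 𝓀[F] = 2 := by
    rw [FiniteField.even_card_iff_char_two, ← Nat.card_eq_fintype_card]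
    exact Nat.even_iff.1 hq
  have h : ((2 : ℕ) : 𝓀[F]) = 0 := (ringChar.spec _ 2).2 (by rw [h2])
  have h' : IsLocalRing.residue 𝒪[F] 2 = 0 := by rw [map_ofNat]; exact_mod_cast h
  have := (mem_maximalIdeal_iff _).1 ((IsLocalRing.residue_eq_zero_iff _).1 h')
  exact this

lemma exists_nrm_sub_sq_lt (hq : Even (Nat.card 𝓀[F])) {u : F} (hu : nrm F u ≤ 1) :
    ∃ s : F, nrm F s ≤ 1 ∧ nrm F (u - s ^ 2) < 1 := by
  have : Fintype 𝓀[F] := Fintype.ofFinite _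
  have h2 : ringChar 𝓀[F] = 2 := by
    rw [FiniteField.even_card_iff_char_two, ← Nat.card_eq_fintype_card]
    exact Nat.even_iff.1 hq
  let u' : 𝒪[F] := ⟨u, (mem_integer_iff _).2 hu⟩
  obtain ⟨s, hs⟩ := FiniteField.isSquare_of_char_two h2 (IsLocalRing.residue 𝒪[F] u')
  obtain ⟨t, rfl⟩ := IsLocalRing.residue_surjective s
  refine ⟨t, nrm_integer_le t, ?_⟩
  have : IsLocalRing.residue 𝒪[F] (u' - t ^ 2) = 0 := by
    rw [map_sub, map_pow, hs]; ring
  have := (mem_maximalIdeal_iff _).1 ((IsLocalRing.residue_eq_zero_iff _).1 this)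
  simpa [u'] using this

end AbsoluteValue

/-! ### Determinants of matrices with bounded entries -/

section Determinant

variable {F : Type*} [Field F] [ValuativeRel F] [TopologicalSpace F] [IsNonarchimedeanLocalField F]
variable {ι : Type*} [Fintype ι] [DecidableEq ι]

/-- The Leibniz bound for a determinant: each permutation contributes at most `∏ s / ∏ t`. -/
lemma nrm_det_mul_prod_le (M : Matrix ι ι F) (s t : ι → ℝ≥0)
    (h : ∀ i j, nrm F (M i j) * t i ≤ s j) : nrm F M.det * ∏ i, t i ≤ ∏ j, s j := by
  by_cases ht : ∏ i, t i = 0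
  · simp [ht]
  rw [← le_div_iff₀ (pos_iff_ne_zero.2 ht), Matrix.det_apply]
  refine Valuation.map_sum_le _ fun τ _ => ?_
  have hs : nrm F (Equiv.Perm.sign τ • ∏ i, M (τ i) i) = ∏ i, nrm F (M (τ i) i) := by
    rcases Int.units_eq_one_or (Equiv.Perm.sign τ) with h | h <;>
      simp [h, Valuation.map_neg]
  rw [hs, le_div_iff₀ (pos_iff_ne_zero.2 ht), ← Equiv.prod_comp τ t, ← Finset.prod_mul_distrib]
  exact Finset.prod_le_prod' fun i _ => h _ _

/-- Matrices of determinant of absolute value `1` that preserve the norm `max ‖x i‖ * t i` form a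
group: the inverse satisfies the same bounds, by Cramer's rule. -/
lemma nrm_inv_mul_le (U : Matrix ι ι F) (t : ι → ℝ≥0) (ht : ∀ i, 0 < t i)
    (hU : nrm F U.det = 1) (h : ∀ i j, nrm F (U i j) * t i ≤ t j) (i j : ι) :
    nrm F (U⁻¹ i j) * t i ≤ t j := by
  have hadj : nrm F (U⁻¹ i j) = nrm F (U.adjugate i j) := by
    rw [Matrix.inv_def, Matrix.smul_apply, smul_eq_mul, map_mul, Ring.inverse_eq_inv', map_inv₀,
      hU, inv_one, one_mul]
  rw [hadj, Matrix.adjugate_apply]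
  have key := nrm_det_mul_prod_le (U.updateRow j (Pi.single i 1)) t (Function.update t j (t i))
    (by
      intro k l
      by_cases hk : k = j
      · subst hk
        by_cases hl : l = i
        · subst hl; simp
        · simp [hl]
      · simpa [hk] using h k l)
  rw [Finset.prod_update_of_mem (Finset.mem_univ j),
    ← Finset.mul_prod_erase _ t (Finset.mem_univ j),
    Finset.sdiff_singleton_eq_erase, ← mul_assoc] at key
  have hpos : 0 < ∏ x ∈ Finset.univ.erase j, t x := Finset.prod_pos fun i _ => ht i
  exact le_of_mul_le_mul_right key hpos

end Determinant

/-! ### Quasi-reduced matrices -/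

lemma dotProduct_mulVec_comm {R ι : Type*} [CommRing R] [Fintype ι] {B : Matrix ι ι R}
    (hB : B.IsSymm) (v w : ι → R) : v ⬝ᵥ B.mulVec w = w ⬝ᵥ B.mulVec v := by
  rw [Matrix.dotProduct_mulVec w, ← Matrix.mulVec_transpose, hB.eq, dotProduct_comm]

lemma dotProduct_mulVec_add {R ι : Type*} [CommRing R] [Fintype ι] {B : Matrix ι ι R}
    (hB : B.IsSymm) (v w : ι → R) :
    (v + w) ⬝ᵥ B.mulVec (v + w) = v ⬝ᵥ B.mulVec v + w ⬝ᵥ B.mulVec w + 2 * (v ⬝ᵥ B.mulVec w) := by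
  rw [Matrix.mulVec_add, add_dotProduct, dotProduct_add, dotProduct_add,
    dotProduct_mulVec_comm hB w v]
  ring

section QuasiReduced

variable {F : Type*} [Field F] [ValuativeRel F] [TopologicalSpace F] [IsNonarchimedeanLocalField F]
variable {ι : Type*}

/-- The metric part of the definition of a reduced form, for an arbitrary index set and weights
`ρ` (which are `ρ i = (1/2) ^ a i` in the applications), with no admissibility condition on the
involution `σ`. In contrast to reduced forms, this notion passes to the blocks of a matrix. -/
structure QuasiReduced (ρ : ι → ℝ≥0) (σ : ι → ι) (B : Matrix ι ι F) : Prop where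
  symm : B.IsSymm
  pos : ∀ i, 0 < ρ i
  invol : ∀ i, σ (σ i) = i
  diag_le : ∀ i, nrm F (B i i) ≤ ρ i ^ 2
  diag_eq : ∀ i, σ i = i → nrm F (B i i) = ρ i ^ 2
  pair : ∀ i, σ i ≠ i → nrm F (2 * B i (σ i)) = ρ i * ρ (σ i)
  other : ∀ i j, j ≠ i → j ≠ σ i → nrm F (2 * B i j) < ρ i * ρ j

/-- The bounds that define `M(a)`, for arbitrary weights `ρ`. -/
structure WeaklyBounded (ρ : ι → ℝ≥0) (C : Matrix ι ι F) : Prop where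
  symm : C.IsSymm
  diag_le : ∀ i, nrm F (C i i) ≤ ρ i ^ 2
  two_mul_le : ∀ i j, nrm F (2 * C i j) ≤ ρ i * ρ j

/-- The strict bounds that define `M⁰(a)`, for arbitrary weights `ρ`. -/
structure StrictlyBounded (ρ : ι → ℝ≥0) (D : Matrix ι ι F) : Prop where
  symm : D.IsSymm
  diag : ∀ i, nrm F (D i i) < ρ i ^ 2
  other : ∀ i j, i ≠ j → nrm F (2 * D i j) < ρ i * ρ j

lemma StrictlyBounded.sub {ρ : ι → ℝ≥0} {D E : Matrix ι ι F} (hD : StrictlyBounded ρ D)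
    (hE : StrictlyBounded ρ E) : StrictlyBounded ρ (D - E) where
  symm := hD.symm.sub hE.symm
  diag i := Valuation.map_sub_lt _ (hD.diag i) (hE.diag i)
  other i j h := by
    rw [Matrix.sub_apply, mul_sub]
    exact Valuation.map_sub_lt _ (hD.other i j h) (hE.other i j h)

lemma StrictlyBounded.neg {ρ : ι → ℝ≥0} {D : Matrix ι ι F} (hD : StrictlyBounded ρ D) :
    StrictlyBounded ρ (-D) where
  symm := hD.symm.neg
  diag i := by simpa [Valuation.map_neg] using hD.diag i
  other i j h := by simpa [Valuation.map_neg] using hD.other i j h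

lemma StrictlyBounded.add {ρ : ι → ℝ≥0} {D E : Matrix ι ι F} (hD : StrictlyBounded ρ D)
    (hE : StrictlyBounded ρ E) : StrictlyBounded ρ (D + E) := by
  simpa using hD.sub hE.neg

variable {ρ : ι → ℝ≥0} {σ : ι → ι} {B : Matrix ι ι F}

lemma QuasiReduced.of_strictlyBounded_sub {B' : Matrix ι ι F} (hB : QuasiReduced ρ σ B)
    (hD : StrictlyBounded ρ (B' - B)) : QuasiReduced ρ σ B' := by
  have e : ∀ i j, B' i j = B i j + (B' - B) i j := fun i j => by simp
  have e2 : ∀ i j, 2 * B' i j = 2 * B i j + 2 * (B' - B) i j := fun i j => by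
    rw [e, mul_add]
  refine ⟨?_, hB.pos, hB.invol, fun i => ?_, fun i hi => ?_, fun i hi => ?_, fun i j h1 h2 => ?_⟩
  · simpa using hD.symm.add hB.symm
  · rw [e]; exact Valuation.map_add_le _ (hB.diag_le i) (hD.diag i).le
  · rw [e, Valuation.map_add_eq_of_lt_left _ (by rw [hB.diag_eq i hi]; exact hD.diag i),
      hB.diag_eq i hi]
  · rw [e2, Valuation.map_add_eq_of_lt_left _ (by rw [hB.pair i hi]; exact hD.other i _ hi.symm),
      hB.pair i hi]
  · rw [e2]; exact Valuation.map_add_lt _ (hB.other i j h1 h2) (hD.other i j h1.symm)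

lemma QuasiReduced.two_mul_diag_lt (hB : QuasiReduced ρ σ B) (h2 : nrm F 2 < 1) (i : ι) :
    nrm F (2 * B i i) < ρ i * ρ i := by
  rw [map_mul, ← sq]
  have := pow_pos (hB.pos i) 2
  calc nrm F 2 * nrm F (B i i) ≤ nrm F 2 * ρ i ^ 2 := by gcongr; exact hB.diag_le i
    _ < 1 * ρ i ^ 2 := by gcongr
    _ = _ := one_mul _

lemma QuasiReduced.two_mul_le (hB : QuasiReduced ρ σ B) (h2 : nrm F 2 < 1) (i j : ι) :
    nrm F (2 * B i j) ≤ ρ i * ρ j := by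
  by_cases h : j = i
  · subst h; exact (hB.two_mul_diag_lt h2 j).le
  by_cases h' : j = σ i
  · subst h'; exact (hB.pair i h).le
  · exact (hB.other i j h h').le

lemma QuasiReduced.two_mul_lt (hB : QuasiReduced ρ σ B) (h2 : nrm F 2 < 1) {i j : ι}
    (h : j ≠ σ i) : nrm F (2 * B i j) < ρ i * ρ j := by
  by_cases h' : j = i
  · subst h'; exact hB.two_mul_diag_lt h2 j
  · exact hB.other i j h' h

lemma QuasiReduced.weaklyBounded (hB : QuasiReduced ρ σ B) (h2 : nrm F 2 < 1) :
    WeaklyBounded ρ B := ⟨hB.symm, hB.diag_le, hB.two_mul_le h2⟩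

lemma nrm_single_mul_le [DecidableEq ι] {M : ℝ≥0} (i : ι) (x : F) (hx : nrm F x * ρ i ≤ M) (k : ι) :
    nrm F (Pi.single (M := fun _ => F) i x k) * ρ k ≤ M := by
  by_cases hk : k = i
  · subst hk; simpa using hx
  · simp [hk]

variable [Fintype ι]

lemma WeaklyBounded.nrm_polar_lt (hB : WeaklyBounded ρ B) {M N : ℝ≥0}
    (hM : 0 < M) (hN : 0 < N) (v w : ι → F) (hv : ∀ k, nrm F (v k) * ρ k ≤ M)
    (hw : ∀ k, nrm F (w k) * ρ k < N) :
    nrm F (2 * (v ⬝ᵥ B.mulVec w)) < M * N := by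
  have hMN : M * N ≠ 0 := (mul_pos hM hN).ne'
  rw [dotProduct, Finset.mul_sum]
  refine Valuation.map_sum_lt _ hMN fun i _ => ?_
  rw [Matrix.mulVec, dotProduct, Finset.mul_sum, Finset.mul_sum]
  refine Valuation.map_sum_lt _ hMN fun k _ => ?_
  have e : 2 * (v i * (B i k * w k)) = (2 * B i k) * v i * w k := by ring
  rw [e, map_mul, map_mul]
  calc nrm F (2 * B i k) * nrm F (v i) * nrm F (w k) ≤ ρ i * ρ k * nrm F (v i) * nrm F (w k) := by
        gcongr; exact hB.two_mul_le i k
    _ = (nrm F (v i) * ρ i) * (nrm F (w k) * ρ k) := by ring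
    _ ≤ M * (nrm F (w k) * ρ k) := by gcongr; exact hv i
    _ < M * N := by gcongr; exact hw k

variable [DecidableEq ι]

lemma WeaklyBounded.nrm_form_lt (hB : WeaklyBounded ρ B) {M : ℝ≥0}
    (hM : 0 < M) (w : ι → F) (hw : ∀ k, nrm F (w k) * ρ k < M) :
    nrm F (w ⬝ᵥ B.mulVec w) < M ^ 2 := by
  have key : ∀ s : Finset ι, nrm F ((∑ k ∈ s, Pi.single k (w k)) ⬝ᵥ
      B.mulVec (∑ k ∈ s, Pi.single k (w k))) < M ^ 2 := by
    intro s
    induction s using Finset.induction_on with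
    | empty => simpa using pow_pos hM 2
    | insert a s ha ih =>
      rw [Finset.sum_insert ha, dotProduct_mulVec_add hB.symm]
      refine Valuation.map_add_lt _ (Valuation.map_add_lt _ ?_ ih) ?_
      · have e : Pi.single a (w a) ⬝ᵥ B.mulVec (Pi.single a (w a)) = B a a * w a ^ 2 := by
          simp; ring
        rw [e, map_mul, map_pow]
        calc nrm F (B a a) * nrm F (w a) ^ 2 ≤ ρ a ^ 2 * nrm F (w a) ^ 2 := by
              gcongr; exact hB.diag_le a
          _ = (nrm F (w a) * ρ a) ^ 2 := by ring
          _ < M ^ 2 := by gcongr; exact hw a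
      · rw [sq]
        refine hB.nrm_polar_lt hM hM _ _ (nrm_single_mul_le _ _ (hw a).le) fun k => ?_
        rw [Finset.sum_apply]
        by_cases hk : k ∈ s
        · rw [Finset.sum_eq_single k (fun b _ hb => by simp [hb.symm]) (fun h => absurd hk h)]
          simpa using hw k
        · rw [Finset.sum_eq_zero]
          · simpa using hM
          · intro b hb
            rw [Pi.single_eq_of_ne]
            rintro rfl; exact hk hb
  have := key Finset.univ
  rwa [Finset.univ_sum_single] at this

/-- If the coordinate `v i` has maximal norm and `i` is paired with `σ i`, then the pairing of `v`
with the basis vector of index `σ i` is as large as the bounds allow. -/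
lemma QuasiReduced.nrm_pairing_eq (hB : QuasiReduced ρ σ B) (h2 : nrm F 2 < 1) {M : ℝ≥0}
    (hM : 0 < M) (v : ι → F) (hv : ∀ k, nrm F (v k) * ρ k ≤ M) {i : ι} (hi : σ i ≠ i)
    (hvi : nrm F (v i) * ρ i = M) : nrm F (2 * B.mulVec v (σ i)) = M * ρ (σ i) := by
  rw [Matrix.mulVec, dotProduct, Finset.mul_sum, ← Finset.add_sum_erase _ _ (Finset.mem_univ i)]
  have hi' : nrm F (2 * (B (σ i) i * v i)) = M * ρ (σ i) := by
    have := hB.pair (σ i) (by rw [hB.invol]; exact hi.symm)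
    rw [hB.invol] at this
    rw [← mul_assoc, map_mul, this, ← hvi]
    ring
  have hpos : 0 < M * ρ (σ i) := mul_pos hM (hB.pos _)
  rw [Valuation.map_add_eq_of_lt_left, hi']
  rw [hi']
  refine Valuation.map_sum_lt _ hpos.ne' fun k hk => ?_
  have hki : k ≠ i := Finset.ne_of_mem_erase hk
  by_cases h0 : v k = 0
  · simpa [h0] using hpos
  have h0' : 0 < nrm F (v k) := by simpa [pos_iff_ne_zero] using h0
  rw [← mul_assoc, map_mul]
  calc nrm F (2 * B (σ i) k) * nrm F (v k) < ρ (σ i) * ρ k * nrm F (v k) := by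
        gcongr; exact hB.two_mul_lt h2 (by rwa [hB.invol])
    _ = (nrm F (v k) * ρ k) * ρ (σ i) := by ring
    _ ≤ M * ρ (σ i) := by gcongr; exact hv k

/-- If only the coordinate `v i` has maximal norm and `B i i` is as large as the bounds allow, then
so is the value of the quadratic form at `v`. -/
lemma QuasiReduced.nrm_form_eq (hB : QuasiReduced ρ σ B) (h2 : nrm F 2 < 1) {M : ℝ≥0}
    (hM : 0 < M) (v : ι → F) {i : ι} (hv : ∀ k, k ≠ i → nrm F (v k) * ρ k < M)
    (hi : nrm F (B i i) = ρ i ^ 2) (hvi : nrm F (v i) * ρ i = M) :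
    nrm F (v ⬝ᵥ B.mulVec v) = M ^ 2 := by
  have e : v = Pi.single i (v i) + Function.update v i 0 := by
    ext k
    by_cases hk : k = i
    · subst hk; simp
    · simp [hk]
  have hw : ∀ k, nrm F (Function.update v i 0 k) * ρ k < M := by
    intro k
    by_cases hk : k = i
    · subst hk; simpa using hM
    · simpa [hk] using hv k hk
  have e1 : Pi.single i (v i) ⬝ᵥ B.mulVec (Pi.single i (v i)) = B i i * v i ^ 2 := by
    simp; ring
  have h1 : nrm F (B i i * v i ^ 2) = M ^ 2 := by
    rw [map_mul, map_pow, hi, ← hvi]; ring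
  rw [e, dotProduct_mulVec_add hB.symm, e1, add_assoc, Valuation.map_add_eq_of_lt_left, h1]
  rw [h1]
  have hb := hB.weaklyBounded h2
  refine Valuation.map_add_lt _ (hb.nrm_form_lt hM _ hw) ?_
  rw [sq]
  exact hb.nrm_polar_lt hM hM _ _ (nrm_single_mul_le _ _ hvi.le) hw

/-- A quasi-reduced matrix is non-degenerate when distinct fixed points of `σ` have weights in
distinct classes modulo the value group. A radical vector would have maximal coordinates only at
fixed points, hence only at one, and its quadratic form would not vanish. -/
lemma QuasiReduced.det_ne_zero (hB : QuasiReduced ρ σ B) (h2 : nrm F 2 < 1)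
    (hfix : ∀ i j, σ i = i → σ j = j → i ≠ j → ∀ x y : F, x ≠ 0 → nrm F x * ρ i ≠ nrm F y * ρ j) :
    B.det ≠ 0 := by
  intro hdet
  obtain ⟨v, hv0, hv⟩ := Matrix.exists_mulVec_eq_zero_iff.2 hdet
  obtain ⟨j, hj⟩ : ∃ j, v j ≠ 0 := Function.ne_iff.1 hv0
  have : Nonempty ι := ⟨j⟩
  obtain ⟨i, hi⟩ := Finite.exists_max fun k => nrm F (v k) * ρ k
  set M := nrm F (v i) * ρ i with hMdef
  have hM : 0 < M := lt_of_lt_of_le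
    (mul_pos (by simpa [pos_iff_ne_zero] using hj) (hB.pos j)) (hi j)
  have hfixed : ∀ k, nrm F (v k) * ρ k = M → σ k = k := by
    intro k hk
    by_contra h
    have := hB.nrm_pairing_eq h2 hM v hi h hk
    rw [hv] at this
    simp only [Pi.zero_apply, mul_zero, map_zero] at this
    exact (mul_pos hM (hB.pos _)).ne this
  have hvi : v i ≠ 0 := by
    rintro h; rw [h] at hMdef; simp at hMdef; exact hM.ne' hMdef
  have := hB.nrm_form_eq h2 hM v (i := i) (fun k hk => lt_of_le_of_ne (hi k) fun h =>
    hfix i k (hfixed i rfl) (hfixed k h) hk.symm (v i) (v k) hvi h.symm)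
    (hB.diag_eq i (hfixed i rfl)) rfl
  rw [hv] at this
  simp only [dotProduct_zero, map_zero] at this
  exact (pow_pos hM 2).ne this

end QuasiReduced

/-! ### Bases adapted to a reduced form -/

section Adapted

/-- The weight `(1/2) ^ a i` attached to the `i`-th basis vector. -/
def weight {ι : Type*} (a : ι → ℕ) (i : ι) : ℝ≥0 := (1 / 2) ^ a i

lemma weight_pos {ι : Type*} (a : ι → ℕ) (i : ι) : 0 < weight a i := by
  unfold weight; positivity

/-- Among the indices `i` of a given parity with `a i ≤ c`, at most one is fixed by `σ` or paired
with an index of value beyond `c`. -/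
lemma IsAdmissible.eq_of_unpaired {n : ℕ} {a : Fin n → ℕ} {σ : Equiv.Perm (Fin n)}
    (hσ : IsAdmissible a σ) (ha : Monotone a) {c : ℕ} {i j : Fin n} (hi : a i ≤ c) (hj : a j ≤ c)
    (hij : a i ≡ a j [MOD 2]) (hi' : σ i = i ∨ c < a (σ i)) (hj' : σ j = j ∨ c < a (σ j)) :
    i = j := by
  have inv : ∀ i, σ (σ i) = i := fun i => by
    have := congrArg (fun τ => τ i) hσ.involutive
    simpa using this
  have plus : ∀ i, a i ≤ c → c < a (σ i) → σ i ∈ PPlus a σ := fun i h1 h2 => by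
    change a (σ (σ i)) < a (σ i)
    rw [inv]; lia
  have minus : ∀ i, a i ≤ c → c < a (σ i) → i ∈ PMinus a σ := fun i h1 h2 => by
    change a i < a (σ i); lia
  have mixed : ∀ i j, a i ≤ c → a j ≤ c → a i ≡ a j [MOD 2] → σ i = i → c < a (σ j) → False := by
    intro i j hi hj hij h1 h2
    have h3 := (hσ.minus_least j (minus j hj h2)).1.2.2
    have := (hσ.zero_greatest i h1.symm).2
      (show σ j ∈ {j | j ∈ PZero σ ∪ PPlus a σ ∧ a j ≡ a i [MOD 2]} from
        ⟨Or.inr (plus j hj h2), h3.trans hij.symm⟩)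
    exact absurd (ha this) (by lia)
  have least : ∀ i j, a i ≤ c → a j ≤ c → a i ≡ a j [MOD 2] → c < a (σ i) → c < a (σ j) →
      σ i ≤ σ j := by
    intro i j hi hj hij h1 h2
    have h3 := (hσ.minus_least j (minus j hj h2)).1.2.2
    refine (hσ.minus_least i (minus i hi h1)).2 ⟨plus j hj h2, ?_, h3.trans hij.symm⟩
    by_contra h
    exact absurd (ha (not_lt.1 h)) (by lia)
  rcases hi' with hi' | hi' <;> rcases hj' with hj' | hj'
  · by_contra h
    exact hσ.zero_parity i hi'.symm j hj'.symm h hij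
  · exact (mixed i j hi hj hij hi' hj').elim
  · exact (mixed j i hj hi hij.symm hj' hi').elim
  · exact σ.injective (le_antisymm (least i j hi hj hij hi' hj') (least j i hj hi hij.symm hj' hi'))

variable {F : Type*} [Field F] [ValuativeRel F] [TopologicalSpace F] [IsNonarchimedeanLocalField F]
variable {n : ℕ} {a : Fin n → ℕ} {σ : Equiv.Perm (Fin n)} {B : Matrix (Fin n) (Fin n) F}

lemma IsReducedForm.quasiReduced (hB : IsReducedForm a σ B) :
    QuasiReduced (weight a) σ B where
  symm := hB.mem.1.1
  pos := weight_pos a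
  invol i := by
    have := congrArg (fun τ => τ i) hB.admissible.involutive
    simpa using this
  diag_le i := (le_ord _ _).1 (hB.mem.2.1 i)
  diag_eq i hi := (ord_eq _ _).1 (hB.ord_diag i (Or.inl hi.symm))
  pair i hi := by
    have := (two_ord_eq _ _).1 (hB.ord_pair i fun h => hi h.symm)
    rwa [pow_add] at this
  other i j h1 h2 := by
    have := (lt_two_ord _ _).1 (hB.ord_other i j h1 h2)
    rwa [pow_add] at this

lemma strictlyBounded_of_mem {D : Matrix (Fin n) (Fin n) F} (hD : D ∈ MZeroSet a) :
    StrictlyBounded (weight a) D where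
  symm := hD.1.1
  diag i := (lt_ord _ _).1 (hD.2.1 i)
  other i j hij := by
    rcases lt_or_gt_of_ne hij with h | h
    · have := (lt_two_ord _ _).1 (hD.2.2 i j h)
      rwa [pow_add] at this
    · have := (lt_two_ord _ _).1 (hD.2.2 j i h)
      rw [hD.1.1.apply] at this
      rw [pow_add] at this
      exact this.trans_eq (mul_comm _ _)

lemma IsReducedForm.of_sub_mem (hB : IsReducedForm a σ B) {B' : Matrix (Fin n) (Fin n) F}
    (hB' : IsHalfIntegral B') (hD : B' - B ∈ MZeroSet a) : IsReducedForm a σ B' := by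
  have hS := strictlyBounded_of_mem hD
  have h := hB.quasiReduced.of_strictlyBounded_sub hS
  have hle : ∀ i j, i ≠ j → nrm F (2 * B' i j) ≤ weight a i * weight a j := by
    intro i j hij
    by_cases hj : j = σ i
    · subst hj; exact (h.pair i hij.symm).le
    · exact (h.other i j hij.symm hj).le
  refine ⟨hB.monotone, hB.admissible,
    ⟨hB', fun i => (le_ord _ _).2 (h.diag_le i), fun i j hij => ?_⟩,
    fun i hi => ?_, fun i hi => ?_, fun i j h1 h2 => ?_⟩
  · rw [le_two_ord, pow_add]; exact hle i j hij.ne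
  · rw [two_ord_eq, pow_add]; exact h.pair i fun h => hi h.symm
  · rw [ord_eq]
    have e : B' i i = B i i + (B' - B) i i := by simp
    have h1 := (ord_eq _ _).1 (hB.ord_diag i hi)
    rw [e, Valuation.map_add_eq_of_lt_left, h1]
    rw [h1]; exact hS.diag i
  · rw [lt_two_ord, pow_add]; exact h.other i j h1 h2

/-- The bounds that the elements of `S(C)` express, in terms of weights. -/
lemma nrm_le_of_mem_SSet {C : Matrix (Fin n) (Fin n) F} (h : a ∈ SSet C) :
    (∀ i, nrm F (C i i) ≤ weight a i ^ 2) ∧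
      ∀ i j, nrm F (2 * C i j) ≤ weight a i * weight a j := by
  refine ⟨fun i => (le_ord _ _).1 (h.2.1 i), fun i j => ?_⟩
  have := (le_two_ord _ _).1 (h.2.2 i j)
  rwa [pow_add] at this

lemma IsReducedForm.mem_SSet (hB : IsReducedForm a σ B) (h2 : nrm F 2 < 1) : a ∈ SSet B := by
  refine ⟨hB.monotone, hB.mem.2.1, fun i j => ?_⟩
  rw [le_two_ord, pow_add]
  exact hB.quasiReduced.two_mul_le h2 i j

/-- The step of the comparison of an adapted basis (the columns of `U`) with the basis of a reduced
form: the bounds at level `c` improve to level `c + 1`. A coordinate `i` violating the improved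
bound would be detected by its partner if `σ i ≠ i` and `a (σ i) ≤ c`, and by the quadratic form itself
otherwise. -/
lemma IsReducedForm.nrm_le_succ (hB : IsReducedForm a σ B) (h2 : nrm F 2 < 1)
    {U W C : Matrix (Fin n) (Fin n) F} (hU : ∀ i j, nrm F (U i j) ≤ 1) (hUW : U * W = 1)
    (hC : C = U.transpose * B * U) {a' : Fin n → ℕ} (ha' : a' ∈ SSet C) {c : ℕ}
    (hf : ∀ i j, nrm F (U i j) * weight a i ≤ (1 / 2) ^ min (a' j) c)
    (hb : ∀ i j, nrm F (W j i) * weight a' j ≤ (1 / 2) ^ min (a i) c) (i j : Fin n) :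
    nrm F (U i j) * weight a i ≤ (1 / 2) ^ min (a' j) (c + 1) := by
  by_cases hj : a' j ≤ c
  · have := hf i j
    rw [min_eq_left hj] at this
    rwa [min_eq_left (by lia : a' j ≤ c + 1)]
  have hq := hB.quasiReduced
  obtain ⟨hC1, hC2⟩ := nrm_le_of_mem_SSet ha'
  set v : Fin n → F := fun k => U k j with hv
  have hM : (0 : ℝ≥0) < (1 / 2) ^ c := by positivity
  have hvk : ∀ k, nrm F (v k) * weight a k ≤ (1 / 2) ^ c := fun k => by
    have := hf k j
    rwa [min_eq_right (by lia)] at this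
  have hwj : weight a' j ≤ (1 / 2) ^ (c + 1) := half_pow_le.2 (by lia)
  rw [min_eq_right (by lia)]
  by_contra hcon
  rw [not_le] at hcon
  -- The exact size of a coordinate in terms of its order, by discreteness of the value group.
  have hord : ∀ k, v k ≠ 0 → ∃ z : ℤ, nrm F (v k) * weight a k = (1 / 2) ^ (2 * z + a k) ∧
      0 ≤ z := by
    intro k hk
    obtain ⟨z, hz⟩ := exists_nrm_eq hk
    refine ⟨z, ?_, ?_⟩
    · rw [hz, weight, ← zpow_natCast, ← zpow_add₀ (by positivity)]
    · have h1 := hU k j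
      change nrm F (v k) ≤ 1 at h1
      replace h1 := h1.trans_eq (zpow_zero (1 / 2 : ℝ≥0)).symm
      rw [hz, half_zpow_le] at h1
      lia
  have hi : nrm F (v i) * weight a i = (1 / 2) ^ c := by
    have hi0 : v i ≠ 0 := by
      intro h
      change _ < nrm F (v i) * _ at hcon
      rw [h] at hcon
      simp at hcon
    obtain ⟨z, hz, -⟩ := hord i hi0
    have h1 := hvk i
    change _ < nrm F (v i) * _ at hcon
    rw [hz, ← zpow_natCast] at h1 hcon
    rw [half_zpow_le] at h1
    rw [half_zpow_lt] at hcon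
    rw [hz, ← zpow_natCast, half_zpow_inj]
    push_cast at hcon
    lia
  have hmax : ∀ k, nrm F (v k) * weight a k = (1 / 2) ^ c →
      a k ≤ c ∧ a k ≡ c [MOD 2] ∧ (σ k = k ∨ c < a (σ k)) := by
    intro k hk
    have hk0 : v k ≠ 0 := by
      intro h
      rw [h] at hk
      simp only [map_zero, zero_mul] at hk
      exact hM.ne hk
    obtain ⟨z, hz, hz0⟩ := hord k hk0
    have hz' := hk
    rw [hz, ← zpow_natCast, half_zpow_inj] at hz'
    refine ⟨by lia, ?_, ?_⟩
    · rw [Nat.ModEq]; lia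
    by_contra hcon'
    push Not at hcon'
    obtain ⟨hσk, hac⟩ := hcon'
    have h1 := hq.nrm_pairing_eq h2 hM v hvk hσk hk
    have hBU : B * U = W.transpose * C := by
      rw [hC, ← Matrix.mul_assoc, ← Matrix.mul_assoc, ← Matrix.transpose_mul, hUW]
      simp
    have h3 : B.mulVec v (σ k) = ∑ l, W l (σ k) * C l j := by
      have := congrFun (congrFun hBU (σ k)) j
      rw [Matrix.mul_apply, Matrix.mul_apply] at this
      exact this
    have h4 : nrm F (2 * B.mulVec v (σ k)) ≤ (1 / 2) ^ (c + 1) * weight a (σ k) := by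
      rw [h3, Finset.mul_sum]
      refine Valuation.map_sum_le _ fun l _ => ?_
      have e : 2 * (W l (σ k) * C l j) = W l (σ k) * (2 * C l j) := by ring
      rw [e, map_mul]
      have h5 := hb (σ k) l
      rw [min_eq_left hac] at h5
      calc nrm F (W l (σ k)) * nrm F (2 * C l j)
          ≤ nrm F (W l (σ k)) * (weight a' l * weight a' j) := by gcongr; exact hC2 l j
        _ = (nrm F (W l (σ k)) * weight a' l) * weight a' j := by ring
        _ ≤ weight a (σ k) * (1 / 2) ^ (c + 1) := by gcongr; exact h5
        _ = _ := mul_comm _ _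
    rw [h1] at h4
    have := le_of_mul_le_mul_right h4 (weight_pos a (σ k))
    rw [half_pow_le] at this
    lia
  have huniq : ∀ k, k ≠ i → nrm F (v k) * weight a k < (1 / 2) ^ c := by
    intro k hk
    refine lt_of_le_of_ne (hvk k) fun h => hk ?_
    obtain ⟨h1, h1', h1''⟩ := hmax k h
    obtain ⟨h2, h2', h2''⟩ := hmax i hi
    exact hB.admissible.eq_of_unpaired hB.monotone h1 h2 (h1'.trans h2'.symm) h1'' h2''
  have hdiag : nrm F (B i i) = weight a i ^ 2 := by
    refine (ord_eq _ _).1 (hB.ord_diag i ?_)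
    obtain ⟨h1, -, h | h⟩ := hmax i hi
    · exact Or.inl h.symm
    · exact Or.inr (lt_of_le_of_lt h1 h)
  have h1 := hq.nrm_form_eq h2 hM v huniq hdiag hi
  have h3 : v ⬝ᵥ B.mulVec v = C j j := by
    rw [hC, Matrix.mul_assoc, Matrix.mul_apply]
    rfl
  rw [h3] at h1
  have h4 : nrm F (C j j) ≤ ((1 / 2) ^ (c + 1)) ^ 2 := (hC1 j).trans (by gcongr)
  rw [h1, ← pow_mul, ← pow_mul, half_pow_le] at h4
  lia

/-- As long as the truncations of `a` and `a'` at level `c` agree, a basis with bounds `a'` spans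
the same filtration as the basis of the reduced form up to level `c`. -/
lemma IsReducedForm.nrm_le_of_min_eq (hB : IsReducedForm a σ B) (h2 : nrm F 2 < 1)
    {U C : Matrix (Fin n) (Fin n) F} (hU : ∀ i j, nrm F (U i j) ≤ 1)
    (hU' : ∀ i j, nrm F (U⁻¹ i j) ≤ 1) (hdet : nrm F U.det = 1)
    (hC : C = U.transpose * B * U) {a' : Fin n → ℕ} (ha' : a' ∈ SSet C) (c : ℕ)
    (hmin : ∀ i, min (a' i) c = min (a i) c) :
    (∀ i j, nrm F (U i j) * weight a i ≤ (1 / 2) ^ min (a' j) c) ∧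
      ∀ i j, nrm F (U⁻¹ j i) * weight a' j ≤ (1 / 2) ^ min (a i) c := by
  have hdet0 : IsUnit U.det := by
    rw [isUnit_iff_ne_zero]; rintro h; rw [h] at hdet; simp at hdet
  induction c with
  | zero =>
    have hw : ∀ (b : Fin n → ℕ) i, weight b i ≤ 1 := fun b i => by
      exact (half_pow_le.2 (Nat.zero_le (b i))).trans_eq (pow_zero _)
    simp only [min_zero, pow_zero]
    exact ⟨fun i j => mul_le_one' (hU i j) (hw _ _), fun i j => mul_le_one' (hU' j i) (hw _ _)⟩
  | succ c ih =>
    obtain ⟨hf, hb⟩ := ih fun i => by have := hmin i; lia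
    have hf' := hB.nrm_le_succ h2 hU (Matrix.mul_nonsing_inv U hdet0) hC ha' hf hb
    refine ⟨hf', fun i j => ?_⟩
    have key := nrm_inv_mul_le U (fun i => (1 / 2) ^ min (a i) (c + 1)) (fun i => by positivity)
      hdet (fun i j => by
        rcases le_total (a i) (c + 1) with h | h
        · have := hf' i j
          rw [hmin j] at this
          rw [min_eq_left h]; exact this
        · rw [min_eq_right h]
          exact (mul_le_of_le_one_left' (hU i j)).trans (half_pow_le.2 (min_le_right _ _))) j i
    refine le_trans ?_ key
    gcongr
    rw [← hmin j]
    exact half_pow_le.2 (min_le_left _ _)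

/-- The sequence `a` of a reduced form is lexicographically maximal. At the first index `k` where a
competitor `a'` exceeds `a`, the filtrations agree up to level `a k`, and the determinant bound at
level `a k + 1` is violated. -/
lemma IsReducedForm.toLex_le (hB : IsReducedForm a σ B) (h2 : nrm F 2 < 1)
    {U C : Matrix (Fin n) (Fin n) F} (hU : ∀ i j, nrm F (U i j) ≤ 1)
    (hU' : ∀ i j, nrm F (U⁻¹ i j) ≤ 1) (hdet : nrm F U.det = 1) (hC : C = U.transpose * B * U)
    {a' : Fin n → ℕ} (ha' : a' ∈ SSet C) :
    toLex a' ≤ toLex a := by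
  by_contra hcon
  rw [not_le] at hcon
  obtain ⟨k, hk1, hk2⟩ := hcon
  change ∀ j < k, a j = a' j at hk1
  change a k < a' k at hk2
  have hge : ∀ i, k ≤ i → a k ≤ a i ∧ a k < a' i := fun i hi =>
    ⟨hB.monotone hi, hk2.trans_le (ha'.1 hi)⟩
  have hmin : ∀ i, min (a' i) (a k) = min (a i) (a k) := by
    intro i
    rcases lt_or_ge i k with h | h
    · rw [hk1 i h]
    · have := hge i h
      lia
  have hdet0 : IsUnit U.det := by
    rw [isUnit_iff_ne_zero]; rintro h; rw [h] at hdet; simp at hdet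
  obtain ⟨hf, hb⟩ := hB.nrm_le_of_min_eq h2 hU hU' hdet hC ha' (a k) hmin
  have hf' := hB.nrm_le_succ h2 hU (Matrix.mul_nonsing_inv U hdet0) hC ha' hf hb
  have key := nrm_det_mul_prod_le U (fun j => (1 / 2) ^ min (a' j) (a k + 1))
    (fun i => (1 / 2) ^ min (a i) (a k + 1)) (fun i j => by
      rcases le_total (a i) (a k + 1) with h | h
      · rw [min_eq_left h]; exact hf' i j
      · rw [min_eq_right h]
        exact (mul_le_of_le_one_left' (hU i j)).trans (half_pow_le.2 (min_le_right _ _)))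
  rw [hdet, one_mul, Finset.prod_pow_eq_pow_sum, Finset.prod_pow_eq_pow_sum, half_pow_le] at key
  refine absurd key (not_le.2 (Finset.sum_lt_sum (fun i _ => ?_) ⟨k, Finset.mem_univ k, ?_⟩))
  · rcases lt_or_ge i k with h | h
    · rw [hk1 i h]
    · have := hge i h
      lia
  · lia

/-- If the columns of `U` realize the maximal sequence `a` itself, then `U⁻¹` is bounded for the
norm with weights `a`. -/
lemma IsReducedForm.nrm_inv_le (hB : IsReducedForm a σ B) (h2 : nrm F 2 < 1)
    {U C : Matrix (Fin n) (Fin n) F} (hU : ∀ i j, nrm F (U i j) ≤ 1)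
    (hU' : ∀ i j, nrm F (U⁻¹ i j) ≤ 1) (hdet : nrm F U.det = 1) (hC : C = U.transpose * B * U)
    (ha : a ∈ SSet C) (i j : Fin n) :
    nrm F (U⁻¹ j i) * weight a j ≤ weight a i := by
  have := (hB.nrm_le_of_min_eq h2 hU hU' hdet hC ha (a i) fun _ => rfl).2 i j
  rwa [min_self] at this

end Adapted

/-! ### Upper left blocks -/

section Blocks

variable {F : Type*} [Field F] [ValuativeRel F] [TopologicalSpace F] [IsNonarchimedeanLocalField F]
variable {ι : Type*} [Fintype ι] [DecidableEq ι]

/-- If `W` is bounded for the norm with weights `ρ`, then, up to strictly smaller terms, the change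
of basis `C ↦ ᵗW C W` commutes with passing to the block of the basis vectors of large weight. -/
lemma WeaklyBounded.strictlyBounded_block {ρ : ι → ℝ≥0} {C W : Matrix ι ι F}
    (hρ : ∀ i, 0 < ρ i) (hC : WeaklyBounded ρ C) (hW1 : ∀ i j, nrm F (W i j) ≤ 1)
    (hW : ∀ i j, nrm F (W i j) * ρ i ≤ ρ j)
    (p : ι → Prop) [DecidablePred p] (hp : ∀ i j, p i → ¬ p j → ρ j < ρ i) :
    StrictlyBounded (fun i : {i // p i} => ρ i)
      ((W.submatrix Subtype.val Subtype.val).transpose *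
          C.submatrix Subtype.val Subtype.val * W.submatrix Subtype.val Subtype.val -
        (W.transpose * C * W).submatrix Subtype.val Subtype.val) := by
  -- The `j`-th column of `W` is `u j + r j`, with `u j` supported in the block.
  let u : ι → ι → F := fun j k => if p k then W k j else 0
  let r : ι → ι → F := fun j k => if p k then 0 else W k j
  have hur : ∀ j, (fun k => W k j) = u j + r j := by
    intro j; ext k
    by_cases h : p k <;> simp [u, r, h]
  have hu : ∀ j k, nrm F (u j k) * ρ k ≤ ρ j := by
    intro j k
    by_cases h : p k
    · simpa [u, h] using hW k j
    · simp [u, h]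
  have hr : ∀ j, p j → ∀ k, nrm F (r j k) * ρ k < ρ j := by
    intro j hj k
    by_cases h : p k
    · simpa [r, h] using hρ j
    · simpa [r, h] using (mul_le_of_le_one_left' (hW1 k j)).trans_lt (hp j k hj h)
  have hbig : ∀ i j : {i // p i}, (W.transpose * C * W).submatrix Subtype.val Subtype.val i j =
      (u i + r i) ⬝ᵥ C.mulVec (u j + r j) := by
    intro i j
    rw [← hur, ← hur, Matrix.submatrix_apply, Matrix.mul_assoc, Matrix.mul_apply]
    rfl
  have hsmall : ∀ i j : {i // p i}, ((W.submatrix Subtype.val Subtype.val).transpose *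
      C.submatrix Subtype.val Subtype.val * W.submatrix Subtype.val Subtype.val :
        Matrix {i // p i} {i // p i} F) i j = u i ⬝ᵥ C.mulVec (u j) := by
    intro i j
    rw [Matrix.mul_assoc, Matrix.mul_apply, dotProduct,
      ← Fintype.sum_subtype_add_sum_subtype p]
    rw [Finset.sum_eq_zero (s := (Finset.univ : Finset {x // ¬ p x}))
      (fun x _ => by simp [u, x.2]), add_zero]
    refine Finset.sum_congr rfl fun k _ => ?_
    rw [Matrix.mul_apply, Matrix.mulVec, dotProduct, ← Fintype.sum_subtype_add_sum_subtype p]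
    rw [Finset.sum_eq_zero (s := (Finset.univ : Finset {x // ¬ p x}))
      (fun x _ => by simp [u, x.2]), add_zero]
    rw [show u i k = W k i from if_pos k.2, Matrix.transpose_apply, Matrix.submatrix_apply]
    congr 1
    refine Finset.sum_congr rfl fun x _ => ?_
    rw [show u j x = W x j from if_pos x.2]
    rfl
  have hsymm : ∀ {κ : Type _} [Fintype κ] (X : Matrix ι κ F), (X.transpose * C * X).IsSymm := by
    intro κ _ X
    rw [Matrix.IsSymm, Matrix.transpose_mul, Matrix.transpose_mul, Matrix.transpose_transpose,
      hC.symm.eq, Matrix.mul_assoc]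
  refine ⟨?_, fun i => ?_, fun i j hij => ?_⟩
  · refine Matrix.IsSymm.sub ?_ ((hsymm W).submatrix _)
    rw [Matrix.IsSymm, Matrix.transpose_mul, Matrix.transpose_mul, Matrix.transpose_transpose,
      (hC.symm.submatrix _).eq, Matrix.mul_assoc]
  · have e : u i ⬝ᵥ C.mulVec (u i) - (u i + r i) ⬝ᵥ C.mulVec (u i + r i) =
        -(r i ⬝ᵥ C.mulVec (r i) + 2 * (u i ⬝ᵥ C.mulVec (r i))) := by
      rw [dotProduct_mulVec_add hC.symm]; ring
    rw [Matrix.sub_apply, hbig, hsmall, e, Valuation.map_neg]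
    refine Valuation.map_add_lt _ (hC.nrm_form_lt (hρ _) _ (hr i i.2)) ?_
    rw [sq]
    exact hC.nrm_polar_lt (hρ _) (hρ _) _ _ (hu i) (hr i i.2)
  · have e : 2 * (u i ⬝ᵥ C.mulVec (u j) - (u i + r i) ⬝ᵥ C.mulVec (u j + r j)) =
        -(2 * (u i ⬝ᵥ C.mulVec (r j)) + 2 * (u j ⬝ᵥ C.mulVec (r i)) +
          2 * (r i ⬝ᵥ C.mulVec (r j))) := by
      rw [dotProduct_mulVec_comm hC.symm (u j) (r i)]
      simp only [Matrix.mulVec_add, add_dotProduct, dotProduct_add]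
      ring
    rw [Matrix.sub_apply, hbig, hsmall, e, Valuation.map_neg]
    refine Valuation.map_add_lt _ (Valuation.map_add_lt _ ?_ ?_) ?_
    · exact hC.nrm_polar_lt (hρ _) (hρ _) _ _ (hu i) (hr j j.2)
    · rw [mul_comm (ρ i)]
      exact hC.nrm_polar_lt (hρ _) (hρ _) _ _ (hu j) (hr i i.2)
    · exact hC.nrm_polar_lt (hρ _) (hρ _) _ _ (fun k => (hr i i.2 k).le) (hr j j.2)

lemma StrictlyBounded.submatrix {ι κ : Type*} {ρ : ι → ℝ≥0} {D : Matrix ι ι F}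
    (hD : StrictlyBounded ρ D) (f : κ → ι) (hf : Function.Injective f) :
    StrictlyBounded (fun k => ρ (f k)) (D.submatrix f f) where
  symm := hD.symm.submatrix f
  diag _ := hD.diag _
  other _ _ hij := hD.other _ _ (hf.ne hij)

/-- The involution induced by `σ` on a subset: indices whose partner lies outside become fixed
points. -/
def truncate {ι : Type*} (p : ι → Prop) [DecidablePred p] (σ : ι → ι) (i : {i // p i}) :
    {i // p i} :=
  if h : p (σ i) then ⟨σ i, h⟩ else i

lemma truncate_eq_self {ι : Type*} {p : ι → Prop} [DecidablePred p] {σ : ι → ι} {i : {i // p i}}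
    (h : truncate p σ i = i) : σ i = i ∨ ¬ p (σ i) := by
  by_cases hp : p (σ i)
  · rw [truncate, dif_pos hp] at h
    exact Or.inl (congrArg Subtype.val h)
  · exact Or.inr hp

variable {n : ℕ} {a : Fin n → ℕ} {σ : Equiv.Perm (Fin n)} {B : Matrix (Fin n) (Fin n) F}

lemma IsReducedForm.quasiReduced_block (hB : IsReducedForm a σ B)
    (p : Fin n → Prop) [DecidablePred p] (hp : ∀ i j, p i → ¬ p j → a i < a j) :
    QuasiReduced (fun i : {i // p i} => weight a i) (truncate p σ)
      (B.submatrix Subtype.val Subtype.val) where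
  symm := hB.quasiReduced.symm.submatrix _
  pos i := weight_pos a i
  invol i := by
    have inv := hB.quasiReduced.invol
    by_cases h : p (σ i)
    · have h1 : truncate p σ i = ⟨σ i, h⟩ := dif_pos h
      have h2 : p (σ (σ i)) := by rw [inv]; exact i.2
      rw [h1]
      have h3 : truncate p σ ⟨σ i, h⟩ = ⟨σ (σ i), h2⟩ := dif_pos h2
      rw [h3]
      exact Subtype.ext (inv i)
    · have h1 : truncate p σ i = i := dif_neg h
      rw [h1, h1]
  diag_le i := hB.quasiReduced.diag_le i
  diag_eq i hi := by
    rw [Matrix.submatrix_apply, weight, ← ord_eq]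
    refine hB.ord_diag i ?_
    rcases truncate_eq_self hi with h | h
    · exact Or.inl h.symm
    · exact Or.inr (hp _ _ i.2 h)
  pair i hi := by
    by_cases h : p (σ i)
    · have h1 : truncate p σ i = ⟨σ i, h⟩ := dif_pos h
      rw [h1] at hi ⊢
      exact hB.quasiReduced.pair i fun h' => hi (Subtype.ext h')
    · exact absurd (dif_neg h) hi
  other i j h1 h2 := by
    refine hB.quasiReduced.other i j (fun h => h1 (Subtype.ext h)) fun h => h2 ?_
    have hpσ : p (σ i) := h ▸ j.2
    have h3 : truncate p σ i = ⟨σ i, hpσ⟩ := dif_pos hpσ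
    rw [h3]
    exact Subtype.ext h

lemma IsReducedForm.not_modEq_of_truncate (hB : IsReducedForm a σ B)
    (p : Fin n → Prop) [DecidablePred p] (hp : ∀ i j, p i → ¬ p j → a i < a j) (i j : {i // p i})
    (hi : truncate p σ i = i) (hj : truncate p σ j = j) (hij : i ≠ j) : ¬ a i ≡ a j [MOD 2] := by
  intro h
  refine hij (Subtype.ext (hB.admissible.eq_of_unpaired hB.monotone (c := max (a i) (a j))
    (le_max_left _ _) (le_max_right _ _) h ?_ ?_))
  · exact (truncate_eq_self hi).imp_right fun h => max_lt (hp _ _ i.2 h) (hp _ _ j.2 h)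
  · exact (truncate_eq_self hj).imp_right fun h => max_lt (hp _ _ i.2 h) (hp _ _ j.2 h)

lemma nrm_mul_weight_ne {ι : Type*} {a : ι → ℕ} {i j : ι} (h : ¬ a i ≡ a j [MOD 2]) {x y : F}
    (hx : x ≠ 0) : nrm F x * weight a i ≠ nrm F y * weight a j := by
  have key : ∀ (z : ℤ) (m : ℕ), (1 / 2 : ℝ≥0) ^ (2 * z) * (1 / 2) ^ m = (1 / 2) ^ (2 * z + m) := by
    intro z m
    rw [← zpow_natCast, ← zpow_add₀ (by positivity)]
  obtain ⟨z, hz⟩ := exists_nrm_eq hx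
  by_cases hy : y = 0
  · rw [hy, map_zero, zero_mul, hz]
    exact (mul_pos (zpow_pos (by positivity) _) (weight_pos a i)).ne'
  obtain ⟨w, hw⟩ := exists_nrm_eq hy
  rw [hz, hw, weight, weight, key, key]
  intro h'
  rw [half_zpow_inj] at h'
  apply h
  rw [Nat.ModEq]
  lia

lemma IsReducedForm.det_ne_zero (hB : IsReducedForm a σ B) (h2 : nrm F 2 < 1) : B.det ≠ 0 :=
  hB.quasiReduced.det_ne_zero h2 fun _ _ hi hj hij _ _ hx =>
    nrm_mul_weight_ne (hB.admissible.zero_parity _ hi.symm _ hj.symm hij) hx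

end Blocks

/-! ### Similarity of matrices over a field -/

section Similar

/-- The quadratic form of `B'` is isometric to `u` times the quadratic form of `B`. -/
def IsSimilar {F ι : Type*} [Field F] [Fintype ι] [DecidableEq ι] (u : F) (B B' : Matrix ι ι F) :
    Prop :=
  ∃ P : Matrix ι ι F, P.det ≠ 0 ∧ B' = u • (P.transpose * B * P)

variable {F ι κ : Type*} [Field F] [Fintype ι] [DecidableEq ι] [Fintype κ] [DecidableEq κ]

lemma IsSimilar.trans {u w : F} {A B C : Matrix ι ι F} (h : IsSimilar u A B)
    (h' : IsSimilar w B C) : IsSimilar (w * u) A C := by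
  obtain ⟨P, hP, rfl⟩ := h
  obtain ⟨Q, hQ, rfl⟩ := h'
  refine ⟨P * Q, by rw [Matrix.det_mul]; exact mul_ne_zero hP hQ, ?_⟩
  simp only [Matrix.transpose_mul, Matrix.mul_smul, Matrix.smul_mul, smul_smul, Matrix.mul_assoc]

lemma IsSimilar.symm {u : F} (hu : u ≠ 0) {A B : Matrix ι ι F} (h : IsSimilar u A B) :
    IsSimilar u⁻¹ B A := by
  obtain ⟨P, hP, rfl⟩ := h
  have hP' : IsUnit P.det := isUnit_iff_ne_zero.2 hP
  refine ⟨P⁻¹, by rw [Matrix.det_nonsing_inv, Ring.inverse_eq_inv']; exact inv_ne_zero hP, ?_⟩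
  have e : P⁻¹.transpose * (P.transpose * A * P) * P⁻¹ = A := by
    rw [Matrix.mul_assoc, Matrix.mul_assoc, Matrix.mul_nonsing_inv P hP', Matrix.mul_one,
      ← Matrix.mul_assoc, ← Matrix.transpose_mul, Matrix.mul_nonsing_inv P hP',
      Matrix.transpose_one, Matrix.one_mul]
  rw [Matrix.mul_smul, Matrix.smul_mul, e, smul_smul, inv_mul_cancel₀ hu, one_smul]

lemma IsSimilar.of_submatrix (e : κ ≃ ι) {u : F} {A B : Matrix ι ι F}
    (h : IsSimilar u (A.submatrix e e) (B.submatrix e e)) : IsSimilar u A B := by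
  obtain ⟨P, hP, h⟩ := h
  refine ⟨P.submatrix e.symm e.symm, by rwa [Matrix.det_submatrix_equiv_self], ?_⟩
  have := congrArg (fun M => M.submatrix e.symm e.symm) h
  simp only [Matrix.submatrix_submatrix, Equiv.self_comp_symm, Matrix.submatrix_id_id] at this
  rw [this]
  change u • (P.transpose * A.submatrix e e * P).submatrix e.symm e.symm = _
  rw [← Matrix.submatrix_mul_equiv _ _ _ e.symm,
    ← Matrix.submatrix_mul_equiv _ _ _ e.symm, Matrix.submatrix_submatrix]
  simp

lemma IsSimilar.fromBlocks {u : F} {A A' : Matrix ι ι F} {B B' : Matrix κ κ F}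
    (hA : IsSimilar u A A') (hB : IsSimilar u B B') :
    IsSimilar u (Matrix.fromBlocks A 0 0 B) (Matrix.fromBlocks A' 0 0 B') := by
  obtain ⟨P, hP, rfl⟩ := hA
  obtain ⟨Q, hQ, rfl⟩ := hB
  refine ⟨Matrix.fromBlocks P 0 0 Q, ?_, ?_⟩
  · rw [Matrix.det_fromBlocks_zero₂₁]; exact mul_ne_zero hP hQ
  · simp [Matrix.fromBlocks_transpose, Matrix.fromBlocks_multiply, Matrix.fromBlocks_smul]

/-- Splitting off a non-degenerate block. -/
lemma isSimilar_schur (K : Matrix ι ι F) (L : Matrix ι κ F) (R : Matrix κ κ F)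
    (hK : K.IsSymm) (hdet : K.det ≠ 0) :
    IsSimilar 1 (Matrix.fromBlocks K 0 0 (R - L.transpose * K⁻¹ * L))
      (Matrix.fromBlocks K L L.transpose R) := by
  have hu : IsUnit K.det := isUnit_iff_ne_zero.2 hdet
  refine ⟨Matrix.fromBlocks 1 (K⁻¹ * L) 0 1, by simp, ?_⟩
  have hK' : K⁻¹.transpose = K⁻¹ := by rw [Matrix.transpose_nonsing_inv, hK.eq]
  rw [one_smul, Matrix.fromBlocks_transpose, Matrix.fromBlocks_multiply,
    Matrix.fromBlocks_multiply]
  simp only [Matrix.transpose_one, Matrix.transpose_zero, Matrix.transpose_mul, hK',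
    Matrix.one_mul, Matrix.mul_one, Matrix.zero_mul, Matrix.mul_zero, add_zero, zero_add]
  congr 1
  · rw [← Matrix.mul_assoc, Matrix.mul_nonsing_inv K hu, Matrix.one_mul]
  · rw [Matrix.mul_assoc, Matrix.nonsing_inv_mul K hu, Matrix.mul_one]
  · rw [Matrix.mul_assoc (L.transpose), Matrix.nonsing_inv_mul K hu, Matrix.mul_one,
      Matrix.mul_assoc, add_sub_cancel]

/-- A non-degenerate binary form that represents `θ ≠ 0` is `θ x² + (det / θ) y²`. -/
lemma isSimilar_diagonal_of_represents (K : Matrix (Fin 2) (Fin 2) F) (hK : K.IsSymm)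
    {θ : F} (hθ : θ ≠ 0) (v : Fin 2 → F) (hv : v ⬝ᵥ K.mulVec v = θ) :
    IsSimilar 1 K !![θ, 0; 0, K.det / θ] := by
  have h10 : K 1 0 = K 0 1 := hK.apply 0 1
  simp only [dotProduct, Matrix.mulVec, Fin.sum_univ_two, h10] at hv
  refine ⟨!![v 0, -(K 0 1 * v 0 + K 1 1 * v 1) / θ; v 1, (K 0 0 * v 0 + K 0 1 * v 1) / θ], ?_, ?_⟩
  · have : v 0 * ((K 0 0 * v 0 + K 0 1 * v 1) / θ) -
        -(K 0 1 * v 0 + K 1 1 * v 1) / θ * v 1 = 1 := by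
      field_simp
      linear_combination hv
    rw [Matrix.det_fin_two_of, this]
    exact one_ne_zero
  · rw [one_smul]
    ext i j
    fin_cases i <;> fin_cases j <;>
      simp [Matrix.mul_apply, Fin.sum_univ_two, h10, Matrix.det_fin_two]
    · linear_combination -hv
    · field_simp
      ring
    · field_simp
      ring
    · field_simp
      linear_combination -(K 0 0 * K 1 1 - K 0 1 ^ 2) * hv

/-- Two binary forms are similar when their determinants agree up to a square and they represent a
common value up to the factor of similitude. -/
lemma isSimilar_of_represents {K K' : Matrix (Fin 2) (Fin 2) F} (hK : K.IsSymm) (hK' : K'.IsSymm)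
    {u c θ : F} (hu : u ≠ 0) (hc : c ≠ 0) (hθ : θ ≠ 0) (v v' : Fin 2 → F)
    (hv : v ⬝ᵥ K.mulVec v = θ) (hv' : v' ⬝ᵥ K'.mulVec v' = u * θ)
    (hdet : K'.det = (u * c) ^ 2 * K.det) : IsSimilar u K K' := by
  have h1 := isSimilar_diagonal_of_represents K hK hθ v hv
  have h2 := isSimilar_diagonal_of_represents K' hK' (mul_ne_zero hu hθ) v' hv'
  have h3 : IsSimilar u !![θ, 0; 0, K.det / θ] !![u * θ, 0; 0, K'.det / (u * θ)] := by
    refine ⟨!![1, 0; 0, c], by simpa using hc, ?_⟩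
    rw [hdet]
    ext i j
    fin_cases i <;> fin_cases j <;> simp [Matrix.mul_apply, Fin.sum_univ_two]
    field_simp
  simpa using (h1.trans h3).trans (h2.symm one_ne_zero)

end Similar

/-! ### Binary blocks -/

section Binary

variable {F : Type*} [Field F] [ValuativeRel F] [TopologicalSpace F] [IsNonarchimedeanLocalField F]

lemma exists_add_mul_add_mul_sq_eq {α b γ θ : F} (hb : b ≠ 0)
    (h : nrm F ((θ - α) * γ) < nrm F b ^ 2) : ∃ t : F, α + b * t + γ * t ^ 2 = θ := by
  have hg : nrm F ((θ - α) * γ / b ^ 2) < 1 := by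
    rw [map_div₀, map_pow]
    exact (div_lt_one₀ (pow_pos (by simpa [pos_iff_ne_zero] using hb) 2)).2 h
  obtain ⟨τ, -, hτ⟩ := exists_add_mul_sq_eq_one hg
  refine ⟨(θ - α) / b * τ, ?_⟩
  field_simp at hτ ⊢
  linear_combination (θ - α) * hτ

/-- If the first coefficient is as large as possible, a perturbed binary form represents every unit
multiple of it: first solve modulo the maximal ideal by a square, then apply Hensel's lemma. -/
lemma exists_represents_of_nrm_eq (hq : Even (Nat.card 𝓀[F])) {ρ₀ ρ₁ : ℝ≥0} (h0 : 0 < ρ₀)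
    (h1 : 0 < ρ₁) {α α' b' γ' u : F} (hα : nrm F α = ρ₀ ^ 2) (hα' : nrm F (α' - α) < ρ₀ ^ 2)
    (hb' : nrm F b' = ρ₀ * ρ₁) (hγ' : nrm F γ' ≤ ρ₁ ^ 2) (hu : nrm F u = 1) :
    ∃ s t : F, α' * s ^ 2 + b' * s * t + γ' * t ^ 2 = u * α := by
  have hα'' : nrm F α' = ρ₀ ^ 2 := by
    rw [← hα] at hα' ⊢
    exact Valuation.map_eq_of_sub_lt _ hα'
  have hρ : 0 < ρ₀ ^ 2 := pow_pos h0 2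
  have hne : α' ≠ 0 := by
    rintro h; rw [h, map_zero] at hα''; exact hρ.ne hα''
  have hx : nrm F (u * α / α') = 1 := by
    rw [map_div₀, map_mul, hu, hα, hα'', one_mul, div_self hρ.ne']
  obtain ⟨s, -, hs⟩ := exists_nrm_sub_sq_lt hq hx.le
  have hs1 : nrm F s = 1 := by
    have h : nrm F (s ^ 2) = nrm F (u * α / α') :=
      Valuation.map_eq_of_sub_lt _ (by rwa [hx, Valuation.map_sub_swap])
    rw [hx, map_pow] at h
    exact (pow_eq_one_iff_of_nonneg zero_le two_ne_zero).1 h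
  have hbs : nrm F (b' * s) = ρ₀ * ρ₁ := by rw [map_mul, hb', hs1, mul_one]
  have hbs0 : b' * s ≠ 0 := by
    rintro h; rw [h, map_zero] at hbs; exact (mul_pos h0 h1).ne hbs
  obtain ⟨t, ht⟩ := exists_add_mul_add_mul_sq_eq (α := α' * s ^ 2) (γ := γ') (θ := u * α) hbs0 (by
    have e : (u * α - α' * s ^ 2) * γ' = α' * (u * α / α' - s ^ 2) * γ' := by
      field_simp
    rw [e, map_mul, map_mul, hα'', hbs]
    calc ρ₀ ^ 2 * nrm F (u * α / α' - s ^ 2) * nrm F γ'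
        ≤ ρ₀ ^ 2 * nrm F (u * α / α' - s ^ 2) * ρ₁ ^ 2 := by gcongr
      _ < ρ₀ ^ 2 * 1 * ρ₁ ^ 2 := by gcongr
      _ = (ρ₀ * ρ₁) ^ 2 := by ring)
  exact ⟨s, t, ht⟩

variable (F) in
lemma exists_nrm_lt {ε : ℝ≥0} (hε : 0 < ε) : ∃ x : F, x ≠ 0 ∧ nrm F x < ε := by
  obtain ⟨N, hN⟩ := exists_pow_lt_of_lt_one hε (show (1 / 4 : ℝ≥0) < 1 by
    rw [← NNReal.coe_lt_coe]; norm_num)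
  obtain ⟨x, hx, hx'⟩ := exists_nrm_eq_quarter_zpow F N
  exact ⟨x, hx, by rw [hx', zpow_natCast]; exact hN⟩

/-- A binary block and a perturbation of it represent a common non-zero value, up to a given unit.
When neither diagonal coefficient is as large as possible, both forms are hyperbolic. -/
lemma exists_common_value (hq : Even (Nat.card 𝓀[F])) {ρ₀ ρ₁ : ℝ≥0} (h0 : 0 < ρ₀)
    (h1 : 0 < ρ₁) {α α' b b' γ γ' u : F} (hα : nrm F α ≤ ρ₀ ^ 2) (hγ : nrm F γ ≤ ρ₁ ^ 2)
    (hα' : nrm F (α' - α) < ρ₀ ^ 2) (hγ' : nrm F (γ' - γ) < ρ₁ ^ 2)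
    (hb : nrm F b = ρ₀ * ρ₁) (hb' : nrm F b' = ρ₀ * ρ₁) (hu : nrm F u = 1) :
    ∃ s t s' t' : F, α * s ^ 2 + b * s * t + γ * t ^ 2 ≠ 0 ∧
      α' * s' ^ 2 + b' * s' * t' + γ' * t' ^ 2 = u * (α * s ^ 2 + b * s * t + γ * t ^ 2) := by
  have hγ'' : nrm F γ' ≤ ρ₁ ^ 2 := by
    have : γ' = γ + (γ' - γ) := by ring
    rw [this]; exact Valuation.map_add_le _ hγ hγ'.le
  have hα'' : nrm F α' ≤ ρ₀ ^ 2 := by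
    have : α' = α + (α' - α) := by ring
    rw [this]; exact Valuation.map_add_le _ hα hα'.le
  rcases eq_or_lt_of_le hα with hα0 | hα0
  · obtain ⟨s, t, h⟩ := exists_represents_of_nrm_eq hq h0 h1 hα0 hα' hb' hγ'' hu
    refine ⟨1, 0, s, t, ?_, by rw [h]; ring⟩
    rintro h
    have : α = 0 := by linear_combination h
    rw [this, map_zero] at hα0
    exact (pow_pos h0 2).ne hα0
  rcases eq_or_lt_of_le hγ with hγ0 | hγ0
  · obtain ⟨s, t, h⟩ := exists_represents_of_nrm_eq hq h1 h0 hγ0 hγ' (hb'.trans (mul_comm _ _))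
      hα'' hu
    refine ⟨0, 1, t, s, ?_, by linear_combination h⟩
    rintro h
    have : γ = 0 := by linear_combination h
    rw [this, map_zero] at hγ0
    exact (pow_pos h1 2).ne hγ0
  have hγ1 : nrm F γ' < ρ₁ ^ 2 := by
    have : γ' = γ + (γ' - γ) := by ring
    rw [this]; exact Valuation.map_add_lt _ hγ0 hγ'
  obtain ⟨θ, hθ0, hθ⟩ := exists_nrm_lt F (pow_pos h0 2)
  have hne : ∀ {c : F}, nrm F c = ρ₀ * ρ₁ → c ≠ 0 := by
    rintro c hc rfl
    rw [map_zero] at hc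
    exact (mul_pos h0 h1).ne hc
  have key : ∀ {x y z w : F}, nrm F x ≤ ρ₀ ^ 2 → nrm F y = ρ₀ * ρ₁ → nrm F z < ρ₁ ^ 2 →
      nrm F w ≤ ρ₀ ^ 2 → ∃ t : F, x + y * t + z * t ^ 2 = w := by
    intro x y z w hx hy hz hw
    refine exists_add_mul_add_mul_sq_eq (hne hy) ?_
    have hρ : 0 < ρ₀ ^ 2 := pow_pos h0 2
    rw [map_mul, hy]
    calc nrm F (w - x) * nrm F z ≤ ρ₀ ^ 2 * nrm F z := by
          gcongr; exact Valuation.map_sub_le _ hw hx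
      _ < ρ₀ ^ 2 * ρ₁ ^ 2 := by gcongr
      _ = (ρ₀ * ρ₁) ^ 2 := by ring
  obtain ⟨t, ht⟩ := key hα hb hγ0 hθ.le
  obtain ⟨t', ht'⟩ := key (w := u * θ) hα'' hb' hγ1 (by rw [map_mul, hu, one_mul]; exact hθ.le)
  refine ⟨1, t, 1, t', ?_, ?_⟩
  · rw [show α * 1 ^ 2 + b * 1 * t + γ * t ^ 2 = θ by linear_combination ht]
    exact hθ0
  · rw [show α * 1 ^ 2 + b * 1 * t + γ * t ^ 2 = θ by linear_combination ht]
    linear_combination ht'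

/-- The discriminant of a binary block, normalized to `1 - 4 x` with `x` integral, changes by a
square under a perturbation. -/
lemma exists_sq_mul_discrim_eq (h2 : nrm F 2 < 1) {ρ₀ ρ₁ : ℝ≥0} (h0 : 0 < ρ₀)
    (h1 : 0 < ρ₁) {α α' b b' γ γ' : F} (hα : nrm F α ≤ ρ₀ ^ 2) (hγ : nrm F γ ≤ ρ₁ ^ 2)
    (hα' : nrm F (α' - α) < ρ₀ ^ 2) (hγ' : nrm F (γ' - γ) < ρ₁ ^ 2)
    (hb : nrm F b = ρ₀ * ρ₁) (hb' : nrm F (b' - b) < ρ₀ * ρ₁) :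
    ∃ c : F, c ≠ 0 ∧ b' ^ 2 - 4 * (α' * γ') = c ^ 2 * (b ^ 2 - 4 * (α * γ)) := by
  have hρ : 0 < ρ₀ * ρ₁ := mul_pos h0 h1
  have hb'' : nrm F b' = ρ₀ * ρ₁ := by
    rw [← hb] at hb' ⊢
    exact Valuation.map_eq_of_sub_lt _ hb'
  have hne : ∀ {c : F}, nrm F c = ρ₀ * ρ₁ → c ≠ 0 := by
    rintro c hc rfl
    rw [map_zero] at hc
    exact hρ.ne hc
  have hb0 := hne hb
  have hb0' := hne hb''
  have h4 : nrm F 4 < 1 := by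
    rw [show (4 : F) = 2 * 2 by norm_num, map_mul]
    exact mul_lt_one_of_nonneg_of_lt_one_left zero_le h2 h2.le
  have hγ'' : nrm F γ' ≤ ρ₁ ^ 2 := by
    have : γ' = γ + (γ' - γ) := by ring
    rw [this]; exact Valuation.map_add_le _ hγ hγ'.le
  have hα'' : nrm F α' ≤ ρ₀ ^ 2 := by
    have : α' = α + (α' - α) := by ring
    rw [this]; exact Valuation.map_add_le _ hα hα'.le
  have hδ : nrm F (b ^ 2 - 4 * (α * γ)) = (ρ₀ * ρ₁) ^ 2 := by
    have hb2 : nrm F (b ^ 2) = (ρ₀ * ρ₁) ^ 2 := by rw [map_pow, hb]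
    rw [Valuation.map_sub_eq_of_lt_left, hb2]
    rw [hb2, map_mul, map_mul]
    calc nrm F 4 * (nrm F α * nrm F γ) ≤ nrm F 4 * (ρ₀ ^ 2 * ρ₁ ^ 2) := by gcongr
      _ < 1 * (ρ₀ ^ 2 * ρ₁ ^ 2) := by gcongr
      _ = (ρ₀ * ρ₁) ^ 2 := by ring
  have hδ0 : b ^ 2 - 4 * (α * γ) ≠ 0 := by
    rintro h; rw [h, map_zero] at hδ; exact (pow_pos hρ 2).ne hδ
  have hnum : nrm F (α * γ * b' ^ 2 - α' * γ' * b ^ 2) < (ρ₀ * ρ₁) ^ 4 := by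
    have e : α * γ * b' ^ 2 - α' * γ' * b ^ 2 = α * γ * (b' + b) * (b' - b) +
        (-(α' * b ^ 2 * (γ' - γ)) + -(γ * b ^ 2 * (α' - α))) := by ring
    have hs : nrm F (b' + b) ≤ ρ₀ * ρ₁ := Valuation.map_add_le _ hb''.le hb.le
    rw [e]
    refine Valuation.map_add_lt _ ?_ (Valuation.map_add_lt _ ?_ ?_)
    · simp only [map_mul]
      calc nrm F α * nrm F γ * nrm F (b' + b) * nrm F (b' - b)
          ≤ ρ₀ ^ 2 * ρ₁ ^ 2 * (ρ₀ * ρ₁) * nrm F (b' - b) := by gcongr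
        _ < ρ₀ ^ 2 * ρ₁ ^ 2 * (ρ₀ * ρ₁) * (ρ₀ * ρ₁) := by gcongr
        _ = _ := by ring
    · simp only [Valuation.map_neg, map_mul, map_pow, hb]
      calc nrm F α' * (ρ₀ * ρ₁) ^ 2 * nrm F (γ' - γ)
          ≤ ρ₀ ^ 2 * (ρ₀ * ρ₁) ^ 2 * nrm F (γ' - γ) := by gcongr
        _ < ρ₀ ^ 2 * (ρ₀ * ρ₁) ^ 2 * ρ₁ ^ 2 := by gcongr
        _ = _ := by ring
    · simp only [Valuation.map_neg, map_mul, map_pow, hb]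
      calc nrm F γ * (ρ₀ * ρ₁) ^ 2 * nrm F (α' - α)
          ≤ ρ₁ ^ 2 * (ρ₀ * ρ₁) ^ 2 * nrm F (α' - α) := by gcongr
        _ < ρ₁ ^ 2 * (ρ₀ * ρ₁) ^ 2 * ρ₀ ^ 2 := by gcongr
        _ = _ := by ring
  obtain ⟨c, hc⟩ := exists_sq_eq_one_add_four_mul
    (y := (α * γ * b' ^ 2 - α' * γ' * b ^ 2) / (b' ^ 2 * (b ^ 2 - 4 * (α * γ)))) (by
      rw [map_div₀, map_mul, map_pow, hb'', hδ]
      refine (div_lt_one₀ (by positivity)).2 (hnum.trans_eq (by ring)))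
  have e : (b' / b * c) ^ 2 * (b ^ 2 - 4 * (α * γ)) = b' ^ 2 - 4 * (α' * γ') := by
    rw [mul_pow, hc]
    generalize hd : b ^ 2 - 4 * (α * γ) = δ at hδ0
    field_simp
    rw [← hd]
    ring
  refine ⟨b' / b * c, fun h => ?_, e.symm⟩
  have hδ' : nrm F (b' ^ 2 - 4 * (α' * γ')) = (ρ₀ * ρ₁) ^ 2 := by
    have hb2 : nrm F (b' ^ 2) = (ρ₀ * ρ₁) ^ 2 := by rw [map_pow, hb'']
    rw [Valuation.map_sub_eq_of_lt_left, hb2]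
    rw [hb2, map_mul, map_mul]
    calc nrm F 4 * (nrm F α' * nrm F γ') ≤ nrm F 4 * (ρ₀ ^ 2 * ρ₁ ^ 2) := by gcongr
      _ < 1 * (ρ₀ ^ 2 * ρ₁ ^ 2) := by gcongr
      _ = (ρ₀ * ρ₁) ^ 2 := by ring
  rw [← e, h, zero_pow two_ne_zero, zero_mul, map_zero] at hδ'
  exact (pow_pos hρ 2).ne hδ'

/-- A binary block and a perturbation of it are similar, with any unit as factor of similitude. -/
lemma isSimilar_binary (hq : Even (Nat.card 𝓀[F])) [CharZero F] {ρ : Fin 2 → ℝ≥0}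
    (hρ : ∀ i, 0 < ρ i) {K K' : Matrix (Fin 2) (Fin 2) F} (hK : WeaklyBounded ρ K)
    (hpair : nrm F (2 * K 0 1) = ρ 0 * ρ 1) (hK' : StrictlyBounded ρ (K' - K)) {u : F}
    (hu : nrm F u = 1) : IsSimilar u K K' := by
  have h2 := nrm_two_lt_one hq
  have hu0 : u ≠ 0 := by rintro rfl; simp at hu
  have hKs' : K'.IsSymm := by simpa using hK'.symm.add hK.symm
  have hα' : nrm F (K' 0 0 - K 0 0) < ρ 0 ^ 2 := hK'.diag 0
  have hγ' : nrm F (K' 1 1 - K 1 1) < ρ 1 ^ 2 := hK'.diag 1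
  have hb' : nrm F (2 * K' 0 1 - 2 * K 0 1) < ρ 0 * ρ 1 := by
    rw [← mul_sub]; exact hK'.other 0 1 (by decide)
  have hb'' : nrm F (2 * K' 0 1) = ρ 0 * ρ 1 := by
    rw [← hpair] at hb' ⊢
    exact Valuation.map_eq_of_sub_lt _ hb'
  obtain ⟨s, t, s', t', hne, heq⟩ := exists_common_value hq (hρ 0) (hρ 1) (hK.diag_le 0)
    (hK.diag_le 1) hα' hγ' hpair hb'' hu
  obtain ⟨c, hc, hdisc⟩ := exists_sq_mul_discrim_eq h2 (hρ 0) (hρ 1) (hK.diag_le 0)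
    (hK.diag_le 1) hα' hγ' hpair hb'
  have h10 : K 1 0 = K 0 1 := hK.symm.apply 0 1
  have h10' : K' 1 0 = K' 0 1 := hKs'.apply 0 1
  refine isSimilar_of_represents hK.symm hKs' hu0 (c := c / u) (div_ne_zero hc hu0) hne
    ![s, t] ![s', t'] ?_ ?_ ?_
  · simp [dotProduct, Matrix.mulVec, Fin.sum_univ_two, h10]; ring
  · rw [← heq]
    simp [dotProduct, Matrix.mulVec, Fin.sum_univ_two, h10']; ring
  · rw [mul_div_cancel₀ c hu0, Matrix.det_fin_two, Matrix.det_fin_two, h10, h10']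
    linear_combination (-1 / 4) * hdisc

end Binary

/-! ### Splitting off binary blocks -/

section Splitting

lemma disc_submatrix_equiv {F ι κ : Type*} [Field F] [Fintype ι] [DecidableEq ι] [Fintype κ]
    [DecidableEq κ] (e : κ ≃ ι) (B : Matrix ι ι F) : disc (B.submatrix e e) = disc B := by
  rw [disc, disc, Matrix.det_submatrix_equiv_self, Fintype.card_congr e]

variable {F : Type*} [Field F] [ValuativeRel F] [TopologicalSpace F] [IsNonarchimedeanLocalField F]

lemma QuasiReduced.submatrix_equiv {ι κ : Type*} {ρ : ι → ℝ≥0} {σ : ι → ι} {B : Matrix ι ι F}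
    (hB : QuasiReduced ρ σ B) (e : κ ≃ ι) :
    QuasiReduced (fun k => ρ (e k)) (fun k => e.symm (σ (e k))) (B.submatrix e e) where
  symm := hB.symm.submatrix e
  pos _ := hB.pos _
  invol k := by simp [hB.invol]
  diag_le _ := hB.diag_le _
  diag_eq k hk := hB.diag_eq _ (by simpa [Equiv.symm_apply_eq] using hk)
  pair k hk := by
    have := hB.pair (e k) (by simpa [Equiv.symm_apply_eq] using hk)
    simpa using this
  other k l h1 h2 := hB.other _ _ (e.injective.ne h1) (by
    intro h; exact h2 ((Equiv.symm_apply_eq e).2 h.symm ▸ rfl))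

/-- Number the elements of `ι` so that two given ones come first. -/
lemma exists_equiv_sum {ι : Type*} {i j : ι} (hij : i ≠ j) :
    ∃ e : Fin 2 ⊕ {k // k ≠ i ∧ k ≠ j} ≃ ι, e (Sum.inl 0) = i ∧ e (Sum.inl 1) = j := by
  classical
  refine ⟨Equiv.ofBijective (Sum.elim ![i, j] Subtype.val) ⟨?_, fun k => ?_⟩, rfl, rfl⟩
  · refine Function.Injective.sumElim ?_ Subtype.val_injective ?_
    · intro x y h
      fin_cases x <;> fin_cases y <;> simp_all
    · intro x y
      fin_cases x
      · exact y.2.1.symm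
      · exact y.2.2.symm
  · by_cases h1 : k = i
    · exact ⟨Sum.inl 0, h1.symm⟩
    by_cases h2 : k = j
    · exact ⟨Sum.inl 1, h2.symm⟩
    exact ⟨Sum.inr ⟨k, h1, h2⟩, rfl⟩

variable {κ : Type*} {ρ : Fin 2 ⊕ κ → ℝ≥0} {σ : Fin 2 ⊕ κ → Fin 2 ⊕ κ}
  {B : Matrix (Fin 2 ⊕ κ) (Fin 2 ⊕ κ) F}

/-- What remains of a matrix after splitting off its first binary block. -/
def schurComplement (B : Matrix (Fin 2 ⊕ κ) (Fin 2 ⊕ κ) F) : Matrix κ κ F :=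
  B.toBlocks₂₂ - B.toBlocks₁₂.transpose * B.toBlocks₁₁⁻¹ * B.toBlocks₁₂

lemma QuasiReduced.nrm_four_mul_det (hB : QuasiReduced ρ σ B) (h2 : nrm F 2 < 1)
    (hσ : σ (Sum.inl 0) = Sum.inl 1) :
    nrm F (4 * B.toBlocks₁₁.det) = (ρ (Sum.inl 0) * ρ (Sum.inl 1)) ^ 2 := by
  have h10 : B (Sum.inl 1) (Sum.inl 0) = B (Sum.inl 0) (Sum.inl 1) := hB.symm.apply _ _
  have e : 4 * B.toBlocks₁₁.det =
      (2 * B (Sum.inl 0) (Sum.inl 0)) * (2 * B (Sum.inl 1) (Sum.inl 1)) -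
        (2 * B (Sum.inl 0) (Sum.inl 1)) ^ 2 := by
    rw [Matrix.det_fin_two]
    simp only [Matrix.toBlocks₁₁, Matrix.of_apply, h10]
    ring
  have hp := hB.pair (Sum.inl 0) (by rw [hσ]; simp)
  rw [hσ] at hp
  have hp2 : nrm F ((2 * B (Sum.inl 0) (Sum.inl 1)) ^ 2) =
      (ρ (Sum.inl 0) * ρ (Sum.inl 1)) ^ 2 := by rw [map_pow, hp]
  rw [e, Valuation.map_sub_eq_of_lt_right, hp2]
  rw [hp2, map_mul]
  calc _ < ρ (Sum.inl 0) * ρ (Sum.inl 0) * (ρ (Sum.inl 1) * ρ (Sum.inl 1)) :=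
        mul_lt_mul'' (hB.two_mul_diag_lt h2 _) (hB.two_mul_diag_lt h2 _) zero_le zero_le
    _ = _ := by ring

lemma QuasiReduced.det_toBlocks_ne_zero (hB : QuasiReduced ρ σ B) (h2 : nrm F 2 < 1)
    (hσ : σ (Sum.inl 0) = Sum.inl 1) : B.toBlocks₁₁.det ≠ 0 := by
  intro h
  have := hB.nrm_four_mul_det h2 hσ
  rw [h, mul_zero, map_zero] at this
  exact (pow_pos (mul_pos (hB.pos _) (hB.pos _)) 2).ne this

/-- Splitting off a binary block does not change the other entries up to smaller terms. -/
lemma QuasiReduced.strictlyBounded_schurComplement_sub (hB : QuasiReduced ρ σ B)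
    (h2 : nrm F 2 < 1) (hσ : σ (Sum.inl 0) = Sum.inl 1) :
    StrictlyBounded (fun k => ρ (Sum.inr k)) (schurComplement B - B.toBlocks₂₂) := by
  have hσ1 : σ (Sum.inl 1) = Sum.inl 0 := by rw [← hσ, hB.invol]
  have h10 : B (Sum.inl 1) (Sum.inl 0) = B (Sum.inl 0) (Sum.inl 1) := hB.symm.apply _ _
  set D := schurComplement B - B.toBlocks₂₂ with hD
  set d := B.toBlocks₁₁.det with hd
  have hd0 : d ≠ 0 := hB.det_toBlocks_ne_zero h2 hσ
  set α := B (Sum.inl 0) (Sum.inl 0)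
  set β := B (Sum.inl 0) (Sum.inl 1)
  set γ := B (Sum.inl 1) (Sum.inl 1)
  set ρ₀ := ρ (Sum.inl 0)
  set ρ₁ := ρ (Sum.inl 1)
  have h0 : 0 < ρ₀ := hB.pos _
  have h1 : 0 < ρ₁ := hB.pos _
  let X : κ → F := fun k => 2 * B (Sum.inl 0) (Sum.inr k)
  let Y : κ → F := fun k => 2 * B (Sum.inl 1) (Sum.inr k)
  have hX : ∀ k, nrm F (X k) < ρ₀ * ρ (Sum.inr k) := fun k =>
    hB.two_mul_lt h2 (by rw [hσ]; simp)
  have hY : ∀ k, nrm F (Y k) < ρ₁ * ρ (Sum.inr k) := fun k =>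
    hB.two_mul_lt h2 (by rw [hσ1]; simp)
  have hentry : ∀ k l, 4 * d * D k l =
      -(γ * (X k * X l) - β * (X k * Y l + Y k * X l) + α * (Y k * Y l)) := by
    intro k l
    have e : D = -(B.toBlocks₁₂.transpose * B.toBlocks₁₁⁻¹ * B.toBlocks₁₂) := by
      rw [hD, schurComplement]; abel
    rw [e, Matrix.inv_def, ← hd, Ring.inverse_eq_inv', Matrix.adjugate_fin_two]
    simp only [Matrix.neg_apply, Matrix.mul_apply, Fin.sum_univ_two, Matrix.transpose_apply,
      Matrix.smul_apply, Matrix.toBlocks₁₂, Matrix.toBlocks₁₁, Matrix.of_apply, smul_eq_mul, X, Y,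
      Matrix.cons_val_zero, Matrix.cons_val_one, Matrix.cons_val', Matrix.cons_val_fin_one, h10]
    field_simp
    ring
  have hβ : nrm F (2 * β) = ρ₀ * ρ₁ := by
    have hp := hB.pair (Sum.inl 0) (by rw [hσ]; simp)
    rwa [hσ] at hp
  have hα : nrm F α ≤ ρ₀ ^ 2 := hB.diag_le _
  have hγ : nrm F γ ≤ ρ₁ ^ 2 := hB.diag_le _
  have hdn : nrm F (4 * d) = (ρ₀ * ρ₁) ^ 2 := hB.nrm_four_mul_det h2 hσ
  have hpos : 0 < (ρ₀ * ρ₁) ^ 2 := by positivity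
  have hγX : ∀ k l, nrm F (γ * (X k * X l)) <
      (ρ₀ * ρ₁) ^ 2 * (ρ (Sum.inr k) * ρ (Sum.inr l)) := by
    intro k l
    rw [map_mul, map_mul]
    calc nrm F γ * (nrm F (X k) * nrm F (X l)) ≤ ρ₁ ^ 2 * (nrm F (X k) * nrm F (X l)) := by gcongr
      _ < ρ₁ ^ 2 * ((ρ₀ * ρ (Sum.inr k)) * (ρ₀ * ρ (Sum.inr l))) := by
        have := mul_lt_mul'' (hX k) (hX l) zero_le zero_le
        gcongr
      _ = _ := by ring
  have hαY : ∀ k l, nrm F (α * (Y k * Y l)) <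
      (ρ₀ * ρ₁) ^ 2 * (ρ (Sum.inr k) * ρ (Sum.inr l)) := by
    intro k l
    rw [map_mul, map_mul]
    calc nrm F α * (nrm F (Y k) * nrm F (Y l)) ≤ ρ₀ ^ 2 * (nrm F (Y k) * nrm F (Y l)) := by gcongr
      _ < ρ₀ ^ 2 * ((ρ₁ * ρ (Sum.inr k)) * (ρ₁ * ρ (Sum.inr l))) := by
        have := mul_lt_mul'' (hY k) (hY l) zero_le zero_le
        gcongr
      _ = _ := by ring
  have hβXY : ∀ k l, nrm F (2 * β * (X k * Y l)) <
      (ρ₀ * ρ₁) ^ 2 * (ρ (Sum.inr k) * ρ (Sum.inr l)) := by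
    intro k l
    rw [map_mul, map_mul (nrm F) (X k), hβ]
    calc ρ₀ * ρ₁ * (nrm F (X k) * nrm F (Y l))
        < ρ₀ * ρ₁ * ((ρ₀ * ρ (Sum.inr k)) * (ρ₁ * ρ (Sum.inr l))) := by
          have := mul_lt_mul'' (hX k) (hY l) zero_le zero_le
          gcongr
      _ = _ := by ring
  refine ⟨?_, fun k => ?_, fun k l _ => ?_⟩
  · ext k l
    have e1 := hentry k l
    have e2 := hentry l k
    have h4 : 4 * d ≠ 0 := by
      intro h; rw [h, map_zero] at hdn; exact hpos.ne hdn
    refine mul_left_cancel₀ h4 ?_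
    rw [Matrix.transpose_apply]
    linear_combination e2 - e1
  · have e : 4 * d * D k k = -(γ * (X k * X k)) + (2 * β * (X k * Y k) + -(α * (Y k * Y k))) := by
      linear_combination hentry k k
    have : nrm F (4 * d * D k k) < (ρ₀ * ρ₁) ^ 2 * (ρ (Sum.inr k) * ρ (Sum.inr k)) := by
      rw [e]
      refine Valuation.map_add_lt _ ?_ (Valuation.map_add_lt _ (hβXY k k) ?_)
      · rw [Valuation.map_neg]; exact hγX k k
      · rw [Valuation.map_neg]; exact hαY k k
    rw [map_mul, hdn] at this
    exact (lt_of_mul_lt_mul_left this hpos.le).trans_eq (sq _).symm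
  · have e : 4 * d * (2 * D k l) = -(2 * (γ * (X k * X l))) +
        ((2 * β * (X k * Y l) + 2 * β * (X l * Y k)) + -(2 * (α * (Y k * Y l)))) := by
      linear_combination 2 * hentry k l
    have h2' : ∀ {x : F} {m : ℝ≥0}, nrm F x < m → nrm F (-(2 * x)) < m := by
      intro x m h
      rw [Valuation.map_neg, map_mul]
      exact (mul_le_of_le_one_left' h2.le).trans_lt h
    have : nrm F (4 * d * (2 * D k l)) < (ρ₀ * ρ₁) ^ 2 * (ρ (Sum.inr k) * ρ (Sum.inr l)) := by
      rw [e]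
      refine Valuation.map_add_lt _ (h2' (hγX k l)) (Valuation.map_add_lt _
        (Valuation.map_add_lt _ (hβXY k l) ?_) (h2' (hαY k l)))
      rw [mul_comm (ρ (Sum.inr k))]
      exact hβXY l k
    rw [map_mul, hdn] at this
    exact lt_of_mul_lt_mul_left this hpos.le

lemma QuasiReduced.exists_restrict (hB : QuasiReduced ρ σ B) (hσ : σ (Sum.inl 0) = Sum.inl 1) :
    ∃ τ : κ → κ, (∀ k, σ (Sum.inr k) = Sum.inr (τ k)) ∧
      QuasiReduced (fun k => ρ (Sum.inr k)) τ B.toBlocks₂₂ := by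
  have hσ1 : σ (Sum.inl 1) = Sum.inl 0 := by rw [← hσ, hB.invol]
  have h : ∀ k, ∃ l, σ (Sum.inr k) = Sum.inr l := by
    intro k
    rcases hk : σ (Sum.inr k) with i | l
    · have := congrArg σ hk
      rw [hB.invol] at this
      fin_cases i
      · exact absurd (this.trans hσ) (by simp)
      · exact absurd (this.trans hσ1) (by simp)
    · exact ⟨l, rfl⟩
  choose τ hτ using h
  have hfix : ∀ k, τ k ≠ k → σ (Sum.inr k) ≠ Sum.inr k := by
    intro k hk h
    rw [hτ] at h
    exact hk (Sum.inr_injective h)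
  refine ⟨τ, hτ, ?_, fun _ => hB.pos _, fun k => ?_, fun _ => hB.diag_le _, fun k hk => ?_,
    fun k hk => ?_, fun k l h1 h2 => ?_⟩
  · exact hB.symm.submatrix Sum.inr
  · apply Sum.inr_injective (α := Fin 2)
    rw [← hτ, ← hτ, hB.invol]
  · exact hB.diag_eq (Sum.inr k) (by rw [hτ, hk])
  · have := hB.pair (Sum.inr k) (hfix k hk)
    rwa [hτ] at this
  · exact hB.other (Sum.inr k) (Sum.inr l) (fun h => h1 (Sum.inr_injective h))
      (fun h => h2 (Sum.inr_injective (by rwa [hτ] at h)))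

lemma QuasiReduced.isSimilar_fromBlocks [Fintype κ] [DecidableEq κ] (hB : QuasiReduced ρ σ B)
    (h2 : nrm F 2 < 1) (hσ : σ (Sum.inl 0) = Sum.inl 1) :
    IsSimilar 1 (Matrix.fromBlocks B.toBlocks₁₁ 0 0 (schurComplement B)) B := by
  have h := isSimilar_schur B.toBlocks₁₁ B.toBlocks₁₂ B.toBlocks₂₂ (hB.symm.submatrix Sum.inl)
    (hB.det_toBlocks_ne_zero h2 hσ)
  have e : B.toBlocks₁₂.transpose = B.toBlocks₂₁ := by
    ext i j; exact hB.symm.apply _ _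
  rw [e, Matrix.fromBlocks_toBlocks] at h
  rw [schurComplement, e]
  exact h

/-- Quasi-reduced matrices that differ by strictly bounded terms are similar, provided that there is
at most one fixed point. By induction on the size: the binary blocks that are split off are similar
with any unit as factor, which can be taken to be the one found for the Schur complements, in the
end the quotient of the diagonal entries at the fixed point. -/
theorem QuasiReduced.exists_isSimilar [CharZero F] (hq : Even (Nat.card 𝓀[F])) {ι : Type*}
    [Fintype ι] [DecidableEq ι] {ρ : ι → ℝ≥0} {σ : ι → ι} {B B' : Matrix ι ι F}
    (hB : QuasiReduced ρ σ B) (hD : StrictlyBounded ρ (B' - B))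
    (hfix : ∀ i j, σ i = i → σ j = j → i = j) : ∃ u : F, nrm F u = 1 ∧ IsSimilar u B B' := by
  have h2 := nrm_two_lt_one hq
  induction hN : Fintype.card ι using Nat.strong_induction_on generalizing ι with
  | _ N ih =>
  by_cases hall : ∀ i, σ i = i
  · rcases isEmpty_or_nonempty ι with hι | ⟨⟨i⟩⟩
    · exact ⟨1, map_one _, 1, by simp, by ext i; exact hι.elim i⟩
    have huniq : ∀ j, j = i := fun j => hfix j i (hall j) (hall i)
    have hBi := hB.diag_eq i (hall i)
    have hBi' := (hB.of_strictlyBounded_sub hD).diag_eq i (hall i)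
    have hpos : 0 < ρ i ^ 2 := pow_pos (hB.pos i) 2
    have h0 : B i i ≠ 0 := by
      intro h; rw [h, map_zero] at hBi; exact hpos.ne hBi
    refine ⟨B' i i / B i i, by rw [map_div₀, hBi, hBi', div_self hpos.ne'], 1, by simp, ?_⟩
    ext j k
    rw [huniq j, huniq k]
    simp [h0]
  push Not at hall
  obtain ⟨i, hi⟩ := hall
  obtain ⟨e, he0, he1⟩ := exists_equiv_sum hi.symm
  have hBe := hB.submatrix_equiv e
  have hDe : StrictlyBounded (fun k => ρ (e k)) (B'.submatrix e e - B.submatrix e e) :=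
    hD.submatrix e e.injective
  have hBe' := hBe.of_strictlyBounded_sub hDe
  have hσe : e.symm (σ (e (Sum.inl 0))) = Sum.inl 1 :=
    (Equiv.symm_apply_eq e).2 (by rw [he0, he1])
  obtain ⟨τ, hτ, hR⟩ := hBe.exists_restrict hσe
  have hS := hBe.strictlyBounded_schurComplement_sub h2 hσe
  have hS' := hBe'.strictlyBounded_schurComplement_sub h2 hσe
  have hRD : StrictlyBounded (fun k => ρ (e (Sum.inr k)))
      ((B'.submatrix e e).toBlocks₂₂ - (B.submatrix e e).toBlocks₂₂) :=
    hDe.submatrix Sum.inr Sum.inr_injective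
  have hKD : StrictlyBounded (fun k => ρ (e (Sum.inl k)))
      ((B'.submatrix e e).toBlocks₁₁ - (B.submatrix e e).toBlocks₁₁) :=
    hDe.submatrix Sum.inl Sum.inl_injective
  have hSD : StrictlyBounded (fun k => ρ (e (Sum.inr k)))
      (schurComplement (B'.submatrix e e) - schurComplement (B.submatrix e e)) := by
    have := (hS'.add hRD).sub hS
    convert this using 1
    abel
  have hτfix : ∀ k, τ k = k → σ (e (Sum.inr k)) = e (Sum.inr k) := by
    intro k hk
    have := hτ k
    rw [hk, Equiv.symm_apply_eq] at this
    exact this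
  have hcard : Fintype.card ι = 2 + Fintype.card {k // k ≠ i ∧ k ≠ σ i} := by
    rw [← Fintype.card_congr e]; simp
  obtain ⟨u, hu, hsim⟩ := ih _ (by lia) (hR.of_strictlyBounded_sub hS) hSD (fun k l hk hl =>
    Sum.inr_injective (e.injective (hfix _ _ (hτfix k hk) (hτfix l hl)))) rfl
  have hK : WeaklyBounded (fun k => ρ (e (Sum.inl k))) (B.submatrix e e).toBlocks₁₁ :=
    ⟨hBe.symm.submatrix Sum.inl, fun k => hBe.diag_le _, fun k l => hBe.two_mul_le h2 _ _⟩
  have hpair := hBe.pair (Sum.inl 0) (by rw [hσe]; simp)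
  rw [hσe] at hpair
  have hbin := isSimilar_binary hq (fun k => hBe.pos _) hK hpair hKD hu
  refine ⟨u, hu, IsSimilar.of_submatrix e ?_⟩
  have h1 := hBe.isSimilar_fromBlocks h2 hσe
  have h1' := hBe'.isSimilar_fromBlocks h2 hσe
  have := ((h1.symm one_ne_zero).trans (hbin.fromBlocks hsim)).trans h1'
  simpa using this

/-- `D` is the discriminant of a polynomial `X² - β X + γ` such that `ord γ` is odd and less than
`ord β²`. After scaling the variable, this is an Eisenstein polynomial. -/
def IsEisensteinDisc (D : F) : Prop :=
  ∃ (β γ : F) (z : ℤ), D = β ^ 2 - 4 * γ ∧ nrm F γ = (1 / 4) ^ (2 * z + 1) ∧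
    nrm F β ^ 2 < nrm F γ

lemma IsEisensteinDisc.mul_sq {D : F} (h : IsEisensteinDisc D) {c : F} (hc : c ≠ 0) :
    IsEisensteinDisc (D * c ^ 2) := by
  obtain ⟨β, γ, z, rfl, hγ, hβ⟩ := h
  obtain ⟨w, -, hw⟩ := exists_ord_eq hc
  refine ⟨β * c, γ * c ^ 2, z + w, by ring, ?_, ?_⟩
  · rw [map_mul, map_pow, hγ, hw, ← zpow_natCast, ← zpow_mul, ← zpow_add₀ (by norm_num)]
    congr 1
    push_cast
    ring
  · rw [map_mul, map_mul, map_pow, mul_pow]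
    have : 0 < nrm F c ^ 2 := pow_pos (by simpa [pos_iff_ne_zero] using hc) 2
    gcongr

lemma IsEisensteinDisc.mul_one_sub (h2 : nrm F 2 < 1) {D : F} (h : IsEisensteinDisc D) {x : F}
    (hx : nrm F x ≤ 1) : IsEisensteinDisc (D * (1 - 4 * x)) := by
  obtain ⟨β, γ, z, rfl, hγ, hβ⟩ := h
  have h4x : nrm F (4 * x) < 1 := by
    rw [show (4 : F) * x = 2 * (2 * x) by ring, map_mul, map_mul]
    exact mul_lt_one_of_nonneg_of_lt_one_left zero_le h2 (mul_le_one' h2.le hx)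
  have h1 : nrm F (1 - 4 * x) = 1 := by
    rw [Valuation.map_sub_eq_of_lt_left _ (by rwa [map_one]), map_one]
  have h3 : nrm F (γ * (1 - 4 * x) + x * β ^ 2) = nrm F γ := by
    have h4 : nrm F (γ * (1 - 4 * x)) = nrm F γ := by rw [map_mul, h1, mul_one]
    rw [Valuation.map_add_eq_of_lt_left, h4]
    rw [h4, map_mul, map_pow]
    exact (mul_le_of_le_one_left' hx).trans_lt hβ
  exact ⟨β, γ * (1 - 4 * x) + x * β ^ 2, z, by ring, by rw [h3, hγ], by rwa [h3]⟩

/-- With exactly two fixed points, whose weights lie in different classes, the discriminant is that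
of an Eisenstein polynomial: the block of the fixed points contributes an Eisenstein polynomial, and
each pair contributes a factor `1 - 4 x` with `x` integral. -/
theorem QuasiReduced.isEisensteinDisc (h2 : nrm F 2 < 1) {ι : Type*} [Fintype ι] [DecidableEq ι]
    {ρ : ι → ℝ≥0} {σ : ι → ι} {B : Matrix ι ι F} (hB : QuasiReduced ρ σ B) {i j : ι} (hij : i ≠ j)
    (hi : σ i = i) (hj : σ j = j) (hfix : ∀ k, σ k = k → k = i ∨ k = j) {z : ℤ}
    (hz : (ρ i * ρ j) ^ 2 = (1 / 4) ^ (2 * z + 1)) : IsEisensteinDisc (disc B) := by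
  induction hN : Fintype.card ι using Nat.strong_induction_on generalizing ι with
  | _ N ih =>
  by_cases hall : ∀ k, σ k = k
  · obtain ⟨e, he0, he1⟩ := exists_equiv_sum hij
    have hempty : IsEmpty {k // k ≠ i ∧ k ≠ j} := ⟨fun k => by
      rcases hfix k (hall k) with h | h
      · exact k.2.1 h
      · exact k.2.2 h⟩
    let f : Fin 2 ≃ ι := (Equiv.sumEmpty _ _).symm.trans e
    have hf0 : f 0 = i := he0
    have hf1 : f 1 = j := he1
    have hγ : nrm F (B i i * B j j) = (ρ i * ρ j) ^ 2 := by
      rw [map_mul, hB.diag_eq i hi, hB.diag_eq j hj, mul_pow]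
    refine ⟨2 * B i j, B i i * B j j, z, ?_, by rw [hγ, hz], ?_⟩
    · rw [← disc_submatrix_equiv f, disc, Matrix.det_fin_two]
      simp only [Matrix.submatrix_apply, hf0, hf1, Fintype.card_fin, hB.symm.apply i j]
      norm_num
      ring
    · rw [hγ]
      have := hB.other i j hij.symm (by rw [hi]; exact hij.symm)
      gcongr
  push Not at hall
  obtain ⟨k, hk⟩ := hall
  obtain ⟨e, he0, he1⟩ := exists_equiv_sum hk.symm
  have hBe := hB.submatrix_equiv e
  have hσe : e.symm (σ (e (Sum.inl 0))) = Sum.inl 1 :=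
    (Equiv.symm_apply_eq e).2 (by rw [he0, he1])
  obtain ⟨τ, hτ, hR⟩ := hBe.exists_restrict hσe
  have hS := hBe.strictlyBounded_schurComplement_sub h2 hσe
  have hcard : Fintype.card ι = 2 + Fintype.card {l // l ≠ k ∧ l ≠ σ k} := by
    rw [← Fintype.card_congr e]; simp
  have hmem : ∀ l, σ l = l → l ≠ k ∧ l ≠ σ k := by
    intro l hl
    refine ⟨fun h => hk (h ▸ hl), fun h => hk ?_⟩
    have := hB.invol k
    rw [← h, hl] at this
    rw [← h, this]
  have hval : ∀ x : {l // l ≠ k ∧ l ≠ σ k}, ∃ y, e (Sum.inr y) = x := by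
    intro x
    rcases hx : e.symm x with y | y
    · rw [Equiv.symm_apply_eq] at hx
      fin_cases y
      · exact absurd (hx.trans he0) x.2.1
      · exact absurd (hx.trans he1) x.2.2
    · exact ⟨y, by rw [← hx, e.apply_symm_apply]⟩
  obtain ⟨i', hi'⟩ := hval ⟨i, hmem i hi⟩
  obtain ⟨j', hj'⟩ := hval ⟨j, hmem j hj⟩
  simp only at hi' hj'
  have hτiff : ∀ l, τ l = l ↔ σ (e (Sum.inr l)) = e (Sum.inr l) := by
    intro l
    rw [← (Sum.inr_injective (α := Fin 2)).eq_iff, ← hτ l, Equiv.symm_apply_eq]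
  have key := ih _ (by lia) (hR.of_strictlyBounded_sub hS) (i := i') (j := j')
    (by rintro rfl; exact hij (hi'.symm.trans hj')) ((hτiff _).2 (by rw [hi', hi]))
    ((hτiff _).2 (by rw [hj', hj]))
    (fun l hl => (hfix _ ((hτiff l).1 hl)).imp
      (fun h => Sum.inr_injective (e.injective (h.trans hi'.symm)))
      (fun h => Sum.inr_injective (e.injective (h.trans hj'.symm))))
    (by rw [hi', hj']; exact hz) rfl
  have hdet0 := hBe.det_toBlocks_ne_zero h2 hσe
  have hu : IsUnit (B.submatrix e e).toBlocks₁₁.det := isUnit_iff_ne_zero.2 hdet0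
  have hdisc : disc B = disc (schurComplement (B.submatrix e e)) *
      (-4 * (B.submatrix e e).toBlocks₁₁.det) := by
    rw [← disc_submatrix_equiv e, disc, disc]
    have : Invertible (B.submatrix e e).toBlocks₁₁ := Matrix.invertibleOfIsUnitDet _ hu
    have hdet : (B.submatrix e e).det = (B.submatrix e e).toBlocks₁₁.det *
        (schurComplement (B.submatrix e e)).det := by
      conv_lhs => rw [← Matrix.fromBlocks_toBlocks (B.submatrix e e)]
      rw [Matrix.det_fromBlocks₁₁, Matrix.invOf_eq_nonsing_inv, schurComplement]
      have e' : (B.submatrix e e).toBlocks₁₂.transpose = (B.submatrix e e).toBlocks₂₁ := by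
        ext i j; exact hBe.symm.apply _ _
      rw [e']
    rw [hdet, Fintype.card_sum, Fintype.card_fin, Nat.add_div_left _ two_pos, pow_succ]
    ring
  set b := 2 * B (e (Sum.inl 0)) (e (Sum.inl 1)) with hbdef
  have hb : nrm F b = ρ (e (Sum.inl 0)) * ρ (e (Sum.inl 1)) := by
    have hpair := hBe.pair (Sum.inl 0) (by rw [hσe]; simp)
    rwa [hσe] at hpair
  have hpos : 0 < ρ (e (Sum.inl 0)) * ρ (e (Sum.inl 1)) := mul_pos (hB.pos _) (hB.pos _)
  have hb0 : b ≠ 0 := by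
    intro h; rw [h, map_zero] at hb; exact hpos.ne hb
  set x := B (e (Sum.inl 0)) (e (Sum.inl 0)) * B (e (Sum.inl 1)) (e (Sum.inl 1)) / b ^ 2
  have hx : nrm F x ≤ 1 := by
    rw [map_div₀, map_mul, map_pow, hb]
    refine (div_le_one₀ (pow_pos hpos 2)).2 ?_
    rw [mul_pow]
    exact mul_le_mul' (hB.diag_le _) (hB.diag_le _)
  have hdetK : -4 * (B.submatrix e e).toBlocks₁₁.det = (1 - 4 * x) * b ^ 2 := by
    have h10 := hB.symm.apply (e (Sum.inl 0)) (e (Sum.inl 1))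
    have hxb : x * b ^ 2 = B (e (Sum.inl 0)) (e (Sum.inl 0)) *
      B (e (Sum.inl 1)) (e (Sum.inl 1)) := div_mul_cancel₀ _ (pow_ne_zero 2 hb0)
    rw [sub_mul, mul_assoc, hxb, hbdef, Matrix.det_fin_two]
    simp only [Matrix.toBlocks₁₁, Matrix.of_apply, Matrix.submatrix_apply, h10]
    ring
  rw [hdisc, hdetK, ← mul_assoc]
  exact (key.mul_one_sub h2 hx).mul_sq hb0

end Splitting

/-! ### Invariance of `η` -/

section Clifford

variable {F : Type*} [Field F]

/-- The map of even Clifford algebras induced by a similitude `f` with `Q' = u Q ∘ f`. It sends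
`v w` to `u (f v) (f w)`. -/
def evenSimilitude {M M' : Type*} [AddCommGroup M] [Module F M] [AddCommGroup M'] [Module F M']
    {Q : QuadraticForm F M} {Q' : QuadraticForm F M'} (f : M' →ₗ[F] M) (u : F)
    (h : ∀ m, Q' m = u * Q (f m)) : CliffordAlgebra.even Q' →ₐ[F] CliffordAlgebra.even Q :=
  CliffordAlgebra.even.lift Q'
    { bilin := u • (CliffordAlgebra.even.ι Q).bilin.compl₁₂ f f
      contract := fun m => by
        simp only [LinearMap.smul_apply, LinearMap.compl₁₂_apply,
          (CliffordAlgebra.even.ι Q).contract, h, map_mul, Algebra.smul_def]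
      contract_mid := fun m₁ m₂ m₃ => by
        simp only [LinearMap.smul_apply, LinearMap.compl₁₂_apply, smul_mul_smul_comm,
          (CliffordAlgebra.even.ι Q).contract_mid, h, smul_smul]
        congr 1
        ring }

lemma evenSimilitude_ι {M M' : Type*} [AddCommGroup M] [Module F M] [AddCommGroup M'] [Module F M']
    {Q : QuadraticForm F M} {Q' : QuadraticForm F M'} (f : M' →ₗ[F] M) (u : F)
    (h : ∀ m, Q' m = u * Q (f m)) (m₁ m₂ : M') :
    evenSimilitude f u h ((CliffordAlgebra.even.ι Q').bilin m₁ m₂) =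
      u • (CliffordAlgebra.even.ι Q).bilin (f m₁) (f m₂) := by
  rw [evenSimilitude, CliffordAlgebra.even.lift_ι]
  rfl

/-- Similar quadratic forms have isomorphic even Clifford algebras. -/
lemma nonempty_even_algEquiv {M M' : Type*} [AddCommGroup M] [Module F M] [AddCommGroup M']
    [Module F M'] {Q : QuadraticForm F M} {Q' : QuadraticForm F M'} (f : M' ≃ₗ[F] M) {u : F}
    (hu : u ≠ 0) (h : ∀ m, Q' m = u * Q (f m)) :
    Nonempty (CliffordAlgebra.even Q' ≃ₐ[F] CliffordAlgebra.even Q) := by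
  have h' : ∀ m, Q m = u⁻¹ * Q' (f.symm m) := fun m => by
    rw [h, f.apply_symm_apply, inv_mul_cancel_left₀ hu]
  refine ⟨AlgEquiv.ofAlgHom (evenSimilitude f.toLinearMap u h)
    (evenSimilitude f.symm.toLinearMap u⁻¹ h') ?_ ?_⟩
  · refine CliffordAlgebra.even.algHom_ext _ (CliffordAlgebra.EvenHom.ext ?_)
    refine LinearMap.ext₂ fun m₁ m₂ => ?_
    simp [evenSimilitude_ι, smul_smul, inv_mul_cancel₀ hu]
  · refine CliffordAlgebra.even.algHom_ext _ (CliffordAlgebra.EvenHom.ext ?_)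
    refine LinearMap.ext₂ fun m₁ m₂ => ?_
    simp [evenSimilitude_ι, smul_smul, mul_inv_cancel₀ hu]

lemma toQuadraticForm'_apply {ι : Type*} [Fintype ι] [DecidableEq ι] (B : Matrix ι ι F)
    (v : ι → F) : B.toQuadraticForm' v = v ⬝ᵥ B.mulVec v := by
  rw [Matrix.toQuadraticForm', LinearMap.BilinMap.toQuadraticMap_apply, Matrix.toLinearMap₂'_apply']

lemma IsSimilar.eta_eq {ι : Type*} [Fintype ι] [DecidableEq ι] {B B' : Matrix ι ι F} {u : F}
    (hu : u ≠ 0) (h : IsSimilar u B B') (hodd : ¬ Even (Fintype.card ι)) : eta B' = eta B := by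
  obtain ⟨P, hP, rfl⟩ := h
  have hP' : IsUnit P.det := isUnit_iff_ne_zero.2 hP
  let f : (ι → F) ≃ₗ[F] (ι → F) := Matrix.toLinearEquiv' P (P.invertibleOfIsUnitDet hP')
  have hf : ∀ v, f v = P.mulVec v := fun v => rfl
  obtain ⟨e⟩ := nonempty_even_algEquiv (Q := B.toQuadraticForm')
    (Q' := (u • (P.transpose * B * P)).toQuadraticForm') f hu (fun v => by
      rw [toQuadraticForm'_apply, toQuadraticForm'_apply, hf, Matrix.smul_mulVec,
        dotProduct_smul, smul_eq_mul, Matrix.mul_assoc, ← Matrix.mulVec_mulVec,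
        Matrix.dotProduct_mulVec, Matrix.vecMul_transpose, ← Matrix.mulVec_mulVec])
  have hsplit : IsSplitAlgebra F (CliffordAlgebra.even
      (u • (P.transpose * B * P)).toQuadraticForm') ↔
      IsSplitAlgebra F (CliffordAlgebra.even B.toQuadraticForm') :=
    ⟨fun ⟨k, ⟨g⟩⟩ => ⟨k, ⟨e.symm.trans g⟩⟩, fun ⟨k, ⟨g⟩⟩ => ⟨k, ⟨e.trans g⟩⟩⟩
  rw [eta, eta, if_neg hodd, if_neg hodd]
  classical exact if_congr hsplit rfl rfl

end Clifford

/-! ### Invariance of `ξ` -/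

section Xi

lemma IsSimilar.exists_disc_eq {F ι : Type*} [Field F] [Fintype ι] [DecidableEq ι]
    {B B' : Matrix ι ι F} {u : F} (hu : u ≠ 0) (h : IsSimilar u B B')
    (heven : Even (Fintype.card ι)) : ∃ c : F, c ≠ 0 ∧ disc B' = disc B * c ^ 2 := by
  obtain ⟨P, hP, rfl⟩ := h
  obtain ⟨m, hm⟩ := heven
  refine ⟨u ^ m * P.det, mul_ne_zero (pow_ne_zero m hu) hP, ?_⟩
  rw [disc, disc, Matrix.det_smul, Matrix.det_mul, Matrix.det_mul, Matrix.det_transpose, hm]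
  ring

lemma isSquare_mul_sq {F : Type*} [Field F] (D : F) {c : F} (hc : c ≠ 0) :
    IsSquare (D * c ^ 2) ↔ IsSquare D := by
  constructor
  · rintro ⟨s, hs⟩
    refine ⟨s / c, ?_⟩
    field_simp
    linear_combination hs
  · rintro ⟨s, rfl⟩
    exact ⟨s * c, by ring⟩

lemma splits_X_sq_sub_C {F L : Type*} [Field F] [Field L] [Algebra F L] {D : F} {δ : L}
    (hδ : δ ^ 2 = algebraMap F L D) :
    ((Polynomial.X ^ 2 - Polynomial.C D : F[X]).map (algebraMap F L)).Splits := by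
  have e : (Polynomial.X ^ 2 - Polynomial.C D : F[X]).map (algebraMap F L) =
      (Polynomial.X - Polynomial.C δ) * (Polynomial.X - Polynomial.C (-δ)) := by
    rw [Polynomial.map_sub, Polynomial.map_pow, Polynomial.map_X, Polynomial.map_C, ← hδ,
      map_pow, map_neg]
    ring
  rw [e]
  exact (Polynomial.Splits.X_sub_C _).mul (Polynomial.Splits.X_sub_C _)

lemma exists_sq_eq_in_splittingField {F : Type*} [Field F] (D : F) :
    ∃ δ : Polynomial.SplittingField (Polynomial.X ^ 2 - Polynomial.C D : F[X]),
      δ ^ 2 = algebraMap F _ D := by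
  have hdeg : (Polynomial.X ^ 2 - Polynomial.C D : F[X]).degree = 2 :=
    Polynomial.degree_X_pow_sub_C two_pos D
  obtain ⟨δ, hδ⟩ := (Polynomial.SplittingField.splits
    (Polynomial.X ^ 2 - Polynomial.C D : F[X])).exists_eval_eq_zero
      (by rw [Polynomial.degree_map, hdeg]; norm_num)
  refine ⟨δ, ?_⟩
  simpa [sub_eq_zero] using hδ

lemma nonempty_splittingField_algEquiv {F : Type*} [Field F] (D : F) {c : F} (hc : c ≠ 0) :
    Nonempty (Polynomial.SplittingField (Polynomial.X ^ 2 - Polynomial.C (D * c ^ 2) : F[X]) ≃ₐ[F]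
      Polynomial.SplittingField (Polynomial.X ^ 2 - Polynomial.C D : F[X])) := by
  obtain ⟨δ, hδ⟩ := exists_sq_eq_in_splittingField D
  obtain ⟨ε, hε⟩ := exists_sq_eq_in_splittingField (D * c ^ 2)
  let f := Polynomial.SplittingField.lift _ (splits_X_sq_sub_C (D := D * c ^ 2)
    (δ := δ * algebraMap F _ c) (by rw [mul_pow, hδ, map_mul, map_pow]))
  let g := Polynomial.SplittingField.lift _ (splits_X_sq_sub_C (D := D)
    (δ := ε * algebraMap F _ c⁻¹) (by
      rw [mul_pow, hε, ← map_pow, ← map_mul, mul_assoc, ← mul_pow, mul_inv_cancel₀ hc, one_pow,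
        mul_one]))
  exact ⟨AlgEquiv.ofBijective f ((Algebra.IsAlgebraic.of_finite F _).algHom_bijective₂ f g).1⟩

lemma isUnramifiedSqrt_mul_sq {F : Type*} [Field F] [ValuativeRel F] (D : F) {c : F} (hc : c ≠ 0) :
    IsUnramifiedSqrt (D * c ^ 2) ↔ IsUnramifiedSqrt D := by
  obtain ⟨e⟩ := nonempty_splittingField_algEquiv D hc
  exact Algebra.FormallyUnramified.iff_of_equiv (e.restrictScalars 𝒪[F]).mapIntegralClosure

lemma IsSimilar.xi_eq {F : Type*} [Field F] [ValuativeRel F] {ι : Type*} [Fintype ι]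
    [DecidableEq ι] {B B' : Matrix ι ι F} {u : F} (hu : u ≠ 0) (h : IsSimilar u B B')
    (heven : Even (Fintype.card ι)) : xi B' = xi B := by
  obtain ⟨c, hc, hD⟩ := h.exists_disc_eq hu heven
  classical
  exact if_congr (by rw [hD]; exact isSquare_mul_sq _ hc) rfl
    (if_congr (by rw [hD]; exact isUnramifiedSqrt_mul_sq _ hc) rfl rfl)

end Xi

/-! ### Eisenstein discriminants -/

section Ramified

variable {F : Type*} [Field F] [ValuativeRel F] [TopologicalSpace F] [IsNonarchimedeanLocalField F]

lemma IsEisensteinDisc.exists_normalized {D : F} (h : IsEisensteinDisc D) :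
    ∃ c β γ : F, c ≠ 0 ∧ D * c ^ 2 = β ^ 2 - 4 * γ ∧ nrm F γ = 1 / 4 ∧ nrm F β ≤ 1 / 4 := by
  obtain ⟨β, γ, z, rfl, hγ, hβ⟩ := h
  obtain ⟨c, hc, hcz⟩ := exists_nrm_eq_quarter_zpow F (-z)
  have hγc : nrm F (γ * c ^ 2) = 1 / 4 := by
    rw [map_mul, map_pow, hγ, hcz, ← zpow_natCast, ← zpow_mul, ← zpow_add₀ (by norm_num)]
    rw [show 2 * z + 1 + -z * ((2 : ℕ) : ℤ) = 1 by push_cast; ring, zpow_one]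
  refine ⟨c, β * c, γ * c ^ 2, hc, by ring, hγc, nrm_lt_one_le ?_⟩
  have hc2 : 0 < nrm F c ^ 2 := pow_pos (by simpa [pos_iff_ne_zero] using hc) 2
  have : nrm F (β * c) ^ 2 < nrm F (γ * c ^ 2) := by
    rw [map_mul, map_mul, map_pow, mul_pow]
    gcongr
  rw [hγc] at this
  by_contra hcon
  rw [not_lt] at hcon
  have h1 : (1 : ℝ≥0) ≤ nrm F (β * c) ^ 2 := one_le_pow₀ hcon
  have h2 := h1.trans_lt this
  rw [← NNReal.coe_lt_coe] at h2
  norm_num at h2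

lemma nrm_le_quarter_of_lt {x y : F} (h : nrm F x < nrm F y) : nrm F x ≤ 1 / 4 * nrm F y := by
  have hy : 0 < nrm F y := zero_le.trans_lt h
  have : nrm F (x / y) < 1 := by rw [map_div₀]; exact (div_lt_one₀ hy).2 h
  have := nrm_lt_one_le this
  rwa [map_div₀, div_le_iff₀ hy] at this

/-- Where the norm form of an Eisenstein polynomial takes an integral value, the second coordinate
is integral. -/
lemma nrm_le_one_of_eisenstein_norm {β γ : F} (hγ : nrm F γ = 1 / 4) (hβ : nrm F β ≤ 1 / 4)
    {x y : F} (h : nrm F (x ^ 2 + (β * x * y + γ * y ^ 2)) ≤ 1) : nrm F y ≤ 1 := by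
  by_contra hy
  rw [not_le] at hy
  have hy4 : 4 ≤ nrm F y := by
    have := nrm_le_quarter_of_lt (x := (1 : F)) (y := y) (by rwa [map_one])
    rw [map_one] at this
    rw [← NNReal.coe_le_coe] at this ⊢
    push_cast at this ⊢
    linarith
  have hγy : nrm F (γ * y ^ 2) = 1 / 4 * nrm F y ^ 2 := by rw [map_mul, map_pow, hγ]
  have hβxy : nrm F (β * x * y) ≤ 1 / 4 * nrm F x * nrm F y := by
    rw [map_mul, map_mul]; gcongr
  rcases le_or_gt (nrm F y) (nrm F x) with hxy | hxy
  · have hx2 : nrm F (x ^ 2) = nrm F x ^ 2 := map_pow _ _ _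
    have hX : (4 : ℝ≥0) ≤ nrm F x := hy4.trans hxy
    rw [Valuation.map_add_eq_of_lt_left, hx2] at h
    · rw [← NNReal.coe_le_coe] at h hX
      push_cast at h hX
      nlinarith
    rw [hx2]
    refine Valuation.map_add_lt _ (hβxy.trans_lt ?_) (hγy.trans_lt ?_) <;>
    · rw [← NNReal.coe_lt_coe]
      rw [← NNReal.coe_le_coe] at hX hxy hy4
      push_cast at hX hxy hy4 ⊢
      nlinarith
  · have hxy' := nrm_le_quarter_of_lt hxy
    rw [← NNReal.coe_le_coe] at hxy' hy4
    push_cast at hxy' hy4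
    have hx0 : (0 : ℝ) ≤ nrm F x := NNReal.coe_nonneg _
    have h1 : nrm F (β * x * y) < 1 / 4 * nrm F y ^ 2 := by
      refine hβxy.trans_lt ?_
      rw [← NNReal.coe_lt_coe]
      push_cast
      nlinarith
    have h2 : nrm F (x ^ 2) < 1 / 4 * nrm F y ^ 2 := by
      rw [map_pow, ← NNReal.coe_lt_coe]
      push_cast
      nlinarith
    rw [← add_assoc, Valuation.map_add_eq_of_lt_right, hγy] at h
    · rw [← NNReal.coe_le_coe] at h
      push_cast at h
      nlinarith
    rw [hγy]
    exact Valuation.map_add_lt _ h2 h1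

lemma not_isSquare_of_eisenstein [CharZero F] {β γ : F} (hγ : nrm F γ = 1 / 4)
    (hβ : nrm F β ≤ 1 / 4) : ¬ IsSquare (β ^ 2 - 4 * γ) := by
  rintro ⟨s, hs⟩
  have hθ : (β + s) / 2 * ((β - s) / 2) = γ := by linear_combination (1 / 4) * hs
  set θ := (β + s) / 2 with hθdef
  have hθ' : (β - s) / 2 = β - θ := by rw [hθdef]; ring
  rw [hθ'] at hθ
  have hn : nrm F θ * nrm F (β - θ) = 1 / 4 := by rw [← map_mul, hθ, hγ]
  rcases le_or_gt (nrm F θ) (nrm F β) with h | h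
  · have h1 : nrm F (β - θ) ≤ 1 / 4 := Valuation.map_sub_le _ hβ (h.trans hβ)
    have h2 : (1 / 4 : ℝ≥0) ≤ 1 / 4 * (1 / 4) := hn.symm.trans_le (mul_le_mul' (h.trans hβ) h1)
    rw [← NNReal.coe_le_coe] at h2
    norm_num at h2
  · rw [Valuation.map_sub_eq_of_lt_right _ h] at hn
    have hθ0 : θ ≠ 0 := by
      rintro h0
      rw [h0, map_zero, zero_mul] at hn
      exact absurd hn (by norm_num)
    obtain ⟨z, hz⟩ := exists_nrm_eq hθ0
    rw [hz, ← zpow_add₀ (by norm_num), show (1 / 4 : ℝ≥0) = (1 / 2) ^ (2 : ℤ) by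
      rw [zpow_two]; norm_num, half_zpow_inj] at hn
    lia

end Ramified

/-! ### Ramification of Eisenstein extensions -/

section RamifiedExtension

/-- If `δ² = D` is not a square in `F`, some automorphism of `F(√D)` maps `δ` to `-δ`. -/
lemma exists_algEquiv_neg {F : Type*} [Field F] [CharZero F] {D : F} (hD : ¬ IsSquare D)
    {δ : Polynomial.SplittingField (Polynomial.X ^ 2 - Polynomial.C D : F[X])}
    (hδ : δ ^ 2 = algebraMap F _ D) :
    ∃ τ : Polynomial.SplittingField (Polynomial.X ^ 2 - Polynomial.C D : F[X]) ≃ₐ[F]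
      Polynomial.SplittingField (Polynomial.X ^ 2 - Polynomial.C D : F[X]), τ δ = -δ := by
  have hnorm : Normal F (Polynomial.SplittingField (Polynomial.X ^ 2 - Polynomial.C D : F[X])) :=
    Normal.of_isSplittingField (Polynomial.X ^ 2 - Polynomial.C D : F[X])
  have hgal : IsGalois F (Polynomial.SplittingField (Polynomial.X ^ 2 - Polynomial.C D : F[X])) :=
    ⟨⟩
  by_contra hcon
  push Not at hcon
  have hfix : δ ∈ (⊥ : IntermediateField F
      (Polynomial.SplittingField (Polynomial.X ^ 2 - Polynomial.C D : F[X]))) := by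
    rw [IsGalois.mem_bot_iff_fixed]
    intro τ
    have h1 : (τ δ) ^ 2 = δ ^ 2 := by rw [← map_pow, hδ, τ.commutes]
    exact (sq_eq_sq_iff_eq_or_eq_neg.1 h1).resolve_right (hcon τ)
  obtain ⟨s, hs⟩ := IntermediateField.mem_bot.1 hfix
  refine hD ⟨s, (algebraMap F (Polynomial.SplittingField
    (Polynomial.X ^ 2 - Polynomial.C D : F[X]))).injective ?_⟩
  rw [← hδ, ← hs, map_mul]
  exact sq _

lemma exists_eq_add_mul {F : Type*} [Field F] {D : F}
    {δ : Polynomial.SplittingField (Polynomial.X ^ 2 - Polynomial.C D : F[X])}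
    (hδ : δ ^ 2 = algebraMap F _ D)
    (s : Polynomial.SplittingField (Polynomial.X ^ 2 - Polynomial.C D : F[X])) :
    ∃ x y : F, s = algebraMap F _ x + algebraMap F _ y * δ := by
  have hs : s ∈ Algebra.adjoin F ((Polynomial.X ^ 2 - Polynomial.C D : F[X]).rootSet
      (Polynomial.SplittingField (Polynomial.X ^ 2 - Polynomial.C D : F[X]))) := by
    rw [Polynomial.SplittingField.adjoin_rootSet]; trivial
  induction hs using Algebra.adjoin_induction with
  | mem t ht =>
    have ht' : t ^ 2 = δ ^ 2 := by
      have := Polynomial.aeval_eq_zero_of_mem_rootSet ht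
      rw [hδ]
      simpa [sub_eq_zero] using this
    rcases sq_eq_sq_iff_eq_or_eq_neg.1 ht' with h | h
    · exact ⟨0, 1, by simp [h]⟩
    · exact ⟨0, -1, by simp [h]⟩
  | algebraMap r => exact ⟨r, 0, by simp⟩
  | add s t _ _ hs ht =>
    obtain ⟨x, y, rfl⟩ := hs
    obtain ⟨z, w, rfl⟩ := ht
    exact ⟨x + z, y + w, by simp only [map_add]; ring⟩
  | mul s t _ _ hs ht =>
    obtain ⟨x, y, rfl⟩ := hs
    obtain ⟨z, w, rfl⟩ := ht
    refine ⟨x * z + y * w * D, x * w + y * z, ?_⟩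
    simp only [map_add, map_mul, ← hδ]
    ring

variable {F : Type*} [Field F] [ValuativeRel F] [TopologicalSpace F] [IsNonarchimedeanLocalField F]

lemma nrm_le_one_of_isIntegral {L : Type*} [Field L] [Algebra F L] [Algebra 𝒪[F] L]
    [IsScalarTower 𝒪[F] F L] {x : F}
    (h : IsIntegral 𝒪[F] (algebraMap F L x)) : nrm F x ≤ 1 := by
  have h' : IsIntegral 𝒪[F] x :=
    (isIntegral_algHom_iff (IsScalarTower.toAlgHom 𝒪[F] F L) (algebraMap F L).injective).1 h
  obtain ⟨y, rfl⟩ := IsIntegrallyClosed.isIntegral_iff.1 h'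
  exact nrm_integer_le y

/-- An endomorphism of an unramified algebra that is the identity modulo `d` is the identity modulo
`d ^ 2`, by uniqueness of lifts along the square-zero ideal `(d) / (d ^ 2)`. -/
lemma sq_dvd_of_formallyUnramified {R S : Type*} [CommRing R] [CommRing S] [Algebra R S]
    [Algebra.FormallyUnramified R S] (g : S →ₐ[R] S) {d : S} (h : ∀ s, d ∣ g s - s) (s : S) :
    d ^ 2 ∣ g s - s := by
  have hJ : IsNilpotent ((Ideal.span {d}).map (Ideal.Quotient.mk (Ideal.span {d ^ 2}))) := by
    refine ⟨2, ?_⟩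
    rw [← Ideal.map_pow, Ideal.span_singleton_pow, Ideal.map_quotient_self]
    rfl
  have hext : (Ideal.Quotient.mkₐ R (Ideal.span {d ^ 2})).comp g =
      Ideal.Quotient.mkₐ R (Ideal.span {d ^ 2}) := by
    refine Algebra.FormallyUnramified.ext _ hJ fun s => ?_
    rw [Ideal.Quotient.eq]
    change Ideal.Quotient.mk _ (g s) - Ideal.Quotient.mk _ s ∈ _
    rw [← map_sub]
    exact Ideal.mem_map_of_mem _ (Ideal.mem_span_singleton.2 (h s))
  have hs := AlgHom.congr_fun hext s
  change Ideal.Quotient.mk _ (g s) = Ideal.Quotient.mk _ s at hs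
  rwa [Ideal.Quotient.eq, Ideal.mem_span_singleton] at hs

/-- A quadratic extension `L = F + F δ` is ramified when the discriminant `D = δ²` is that of an
Eisenstein polynomial. The conjugation acts trivially on the integers modulo `δ`, so modulo `δ²` it
is a lift of the identity; it is not the identity there, because `δ` is not a unit. -/
lemma not_formallyUnramified_of_eisenstein [CharZero F] (h2 : nrm F 2 < 1) {L : Type*} [Field L]
    [Algebra F L] [Algebra 𝒪[F] L] [IsScalarTower 𝒪[F] F L] {β γ : F}
    (hγ : nrm F γ = 1 / 4) (hβ : nrm F β ≤ 1 / 4) {δ : L}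
    (hδ : δ ^ 2 = algebraMap F L (β ^ 2 - 4 * γ)) (τ : L ≃ₐ[F] L) (hτ : τ δ = -δ)
    (hL : ∀ s : L, ∃ x y : F, s = algebraMap F L x + algebraMap F L y * δ) :
    ¬ Algebra.FormallyUnramified 𝒪[F] (integralClosure 𝒪[F] L) := by
  intro hunr
  have : CharZero L := charZero_of_injective_algebraMap (algebraMap F L).injective
  have hOL : ∀ x : 𝒪[F], algebraMap 𝒪[F] L x = algebraMap F L (x : F) := fun x =>
    IsScalarTower.algebraMap_apply 𝒪[F] F L x
  obtain ⟨D, hD⟩ : ∃ D, D = β ^ 2 - 4 * γ := ⟨_, rfl⟩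
  rw [← hD] at hδ
  have hlt : (1 / 4 : ℝ≥0) < 1 := by rw [← NNReal.coe_lt_coe]; norm_num
  have hD1 : nrm F D < 1 := by
    rw [hD]
    refine Valuation.map_sub_lt _ ?_ ?_
    · rw [map_pow]; exact pow_lt_one₀ zero_le (hβ.trans_lt hlt) two_ne_zero
    · rw [map_mul, hγ, show (4 : F) = 2 * 2 by norm_num, map_mul]
      exact mul_lt_one_of_nonneg_of_lt_one_left zero_le
        (mul_lt_one_of_nonneg_of_lt_one_left zero_le h2 h2.le) hlt.le
  have hδ0 : δ ≠ 0 := by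
    rintro rfl
    refine not_isSquare_of_eisenstein hγ hβ ⟨0, (algebraMap F L).injective ?_⟩
    rw [← hD, ← hδ]; simp
  let S := integralClosure 𝒪[F] L
  let D' : 𝒪[F] := ⟨D, (mem_integer_iff D).2 hD1.le⟩
  have hδS : δ ∈ S := by
    refine IsIntegral.of_pow two_pos ?_
    rw [hδ, show algebraMap F L D = algebraMap 𝒪[F] L D' from (hOL D').symm]
    exact isIntegral_algebraMap
  let δ' : S := ⟨δ, hδS⟩
  let τ' : S →ₐ[𝒪[F]] S := ((τ.restrictScalars 𝒪[F]).mapIntegralClosure : S ≃ₐ[𝒪[F]] S)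
  have hτ' : ∀ s : S, ((τ' s : S) : L) = τ s := fun s => rfl
  -- Elements of `S` in terms of the root `(β + δ) / 2` of the Eisenstein polynomial.
  have hcoord : ∀ s : S, ∃ x y : F, nrm F y ≤ 1 ∧ nrm F (x ^ 2 + (β * x * y + γ * y ^ 2)) ≤ 1 ∧
      (s : L) = algebraMap F L (x + y * β / 2) + algebraMap F L (y / 2) * δ ∧
      (s : L) * τ s = algebraMap F L (x ^ 2 + (β * x * y + γ * y ^ 2)) := by
    intro s
    obtain ⟨x, y, hxy⟩ := hL s
    have hs : (s : L) = algebraMap F L ((x - y * β) + (2 * y) * β / 2) +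
        algebraMap F L ((2 * y) / 2) * δ := by
      rw [hxy]
      congr 2
      · ring
      · congr 1; ring
    have hN : (s : L) * τ s =
        algebraMap F L ((x - y * β) ^ 2 + (β * (x - y * β) * (2 * y) + γ * (2 * y) ^ 2)) := by
      have h1 : (x - y * β) ^ 2 + (β * (x - y * β) * (2 * y) + γ * (2 * y) ^ 2) =
        x ^ 2 - y ^ 2 * D := by rw [hD]; ring
      rw [h1, hxy, map_add, map_mul, τ.commutes, τ.commutes, hτ, map_sub, map_mul, map_pow, map_pow,
        ← hδ]
      ring
    have hint : nrm F ((x - y * β) ^ 2 + (β * (x - y * β) * (2 * y) + γ * (2 * y) ^ 2)) ≤ 1 := by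
      refine nrm_le_one_of_isIntegral (L := L) ?_
      rw [← hN, ← hτ']
      exact (s * τ' s).2
    exact ⟨x - y * β, 2 * y, nrm_le_one_of_eisenstein_norm hγ hβ hint, hint, hs, hN⟩
  have hcongr : ∀ s : S, δ' ∣ τ' s - s := by
    intro s
    obtain ⟨x, y, hy, -, hs, -⟩ := hcoord s
    let y' : 𝒪[F] := ⟨y, (mem_integer_iff y).2 hy⟩
    refine ⟨-algebraMap 𝒪[F] S y', Subtype.ext ?_⟩
    change τ (s : L) - (s : L) = δ * -algebraMap 𝒪[F] L y'
    rw [hOL]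
    change τ (s : L) - (s : L) = δ * -algebraMap F L y
    rw [hs, map_add, map_mul, τ.commutes, τ.commutes, hτ]
    have : (algebraMap F L y) = algebraMap F L (y / 2) + algebraMap F L (y / 2) := by
      rw [← map_add, add_halves]
    rw [this]
    ring
  -- Apply the congruence modulo `δ²` to the root `(β + δ) / 2`.
  have hroot : (algebraMap F L β + δ) / 2 ∈ S := by
    refine ⟨Polynomial.X ^ 2 - Polynomial.C ⟨β, (mem_integer_iff β).2 (hβ.trans hlt.le)⟩ *
      Polynomial.X + Polynomial.C ⟨γ, (mem_integer_iff γ).2 (by rw [hγ]; exact hlt.le)⟩,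
      by monicity!, ?_⟩
    have hγL : δ ^ 2 = algebraMap F L β ^ 2 - 4 * algebraMap F L γ := by
      rw [hδ, hD, map_sub, map_pow, map_mul, map_ofNat]
    simp only [Polynomial.eval₂_add, Polynomial.eval₂_sub, Polynomial.eval₂_mul,
      Polynomial.eval₂_pow, Polynomial.eval₂_X, Polynomial.eval₂_C, hOL]
    change ((algebraMap F L β + δ) / 2) ^ 2 -
      algebraMap F L β * ((algebraMap F L β + δ) / 2) + algebraMap F L γ = 0
    field_simp
    linear_combination hγL
  obtain ⟨s, hs⟩ := sq_dvd_of_formallyUnramified τ' hcongr ⟨_, hroot⟩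
  have hs' : (s : L) * δ ^ 2 = -δ := by
    have h := congrArg (Subtype.val) hs
    change τ ((algebraMap F L β + δ) / 2) - (algebraMap F L β + δ) / 2 = δ ^ 2 * (s : L) at h
    rw [mul_comm, ← h, map_div₀, map_add, τ.commutes, hτ, map_ofNat]
    ring
  have hs1 : (s : L) * δ = -1 := by
    refine mul_right_cancel₀ hδ0 ?_
    linear_combination hs'
  obtain ⟨x, y, -, hn, -, hN⟩ := hcoord s
  set N := x ^ 2 + (β * x * y + γ * y ^ 2)
  have hND : N * D = -1 := by
    refine (algebraMap F L).injective ?_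
    have h3 : τ (s : L) * -δ = -1 := by
      rw [← hτ, ← map_mul, hs1, map_neg, map_one]
    rw [map_mul, ← hN, ← hδ, map_neg, map_one]
    linear_combination (τ (s : L) * δ) * hs1 + h3
  have : nrm F (N * D) < 1 := by
    rw [map_mul]
    exact mul_lt_one_of_nonneg_of_lt_one_right hn zero_le hD1
  rw [hND, Valuation.map_neg, map_one] at this
  exact lt_irrefl _ this

lemma not_isUnramifiedSqrt_of_eisenstein [CharZero F] (h2 : nrm F 2 < 1) {β γ : F}
    (hγ : nrm F γ = 1 / 4) (hβ : nrm F β ≤ 1 / 4) : ¬ IsUnramifiedSqrt (β ^ 2 - 4 * γ) := by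
  obtain ⟨δ, hδ⟩ := exists_sq_eq_in_splittingField (β ^ 2 - 4 * γ)
  obtain ⟨τ, hτ⟩ := exists_algEquiv_neg (not_isSquare_of_eisenstein hγ hβ) hδ
  exact not_formallyUnramified_of_eisenstein h2 hγ hβ hδ τ hτ (exists_eq_add_mul hδ)

lemma IsEisensteinDisc.xi_eq_zero [CharZero F] (h2 : nrm F 2 < 1) {ι : Type*} [Fintype ι]
    [DecidableEq ι] {B : Matrix ι ι F} (h : IsEisensteinDisc (disc B)) : xi B = 0 := by
  obtain ⟨c, β, γ, hc, heq, hγ, hβ⟩ := h.exists_normalized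
  have h1 : ¬ IsSquare (disc B) := by
    rw [← isSquare_mul_sq _ hc, heq]
    exact not_isSquare_of_eisenstein hγ hβ
  have h3 : ¬ IsUnramifiedSqrt (disc B) := by
    rw [← isUnramifiedSqrt_mul_sq _ hc, heq]
    exact not_isUnramifiedSqrt_of_eisenstein h2 hγ hβ
  rw [xi, if_neg h1, if_neg h3]

end RamifiedExtension

/-! ### Invariants of a block -/

section Invariants

variable {F : Type*} [Field F] [ValuativeRel F] [TopologicalSpace F] [IsNonarchimedeanLocalField F]

lemma even_card_iff_of_involutive {ι : Type*} [Fintype ι] [DecidableEq ι] {σ : ι → ι}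
    (hσ : ∀ i, σ (σ i) = i) :
    Even (Fintype.card ι) ↔ Even (Finset.univ.filter fun i => σ i = i).card := by
  have : Fact (Nat.Prime 2) := ⟨Nat.prime_two⟩
  have h := Equiv.Perm.card_fixedPoints_modEq (f := (σ : Function.End ι)) (p := 2) (n := 1)
    (by rw [pow_one]; exact funext hσ)
  have h' : Fintype.card (Function.fixedPoints σ) = (Finset.univ.filter fun i => σ i = i).card := by
    rw [← Fintype.card_subtype]
    exact Fintype.card_congr (Equiv.refl _)
  rw [h', Nat.ModEq] at h
  rw [Nat.even_iff, Nat.even_iff, h]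

/-- The invariants `ξ` and `η` of a quasi-reduced matrix whose fixed indices have values of
different parity do not change under strictly bounded perturbations. There are at most two fixed
indices. With at most one, the two forms are similar; with two, both have `ξ = 0`. -/
lemma QuasiReduced.invariants_eq [CharZero F] (hq : Even (Nat.card 𝓀[F])) {ι : Type*} [Fintype ι]
    [DecidableEq ι] {a : ι → ℕ} {σ : ι → ι} {B B' : Matrix ι ι F}
    (hB : QuasiReduced (weight a) σ B) (hD : StrictlyBounded (weight a) (B' - B))
    (hfix : ∀ i j, σ i = i → σ j = j → i ≠ j → ¬ a i ≡ a j [MOD 2]) :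
    (Even (Fintype.card ι) → xi B' = xi B) ∧ (¬ Even (Fintype.card ι) → eta B' = eta B) := by
  have h2 := nrm_two_lt_one hq
  by_cases hone : ∀ i j, σ i = i → σ j = j → i = j
  · obtain ⟨u, hu, hsim⟩ := hB.exists_isSimilar hq hD hone
    have hu0 : u ≠ 0 := by rintro rfl; simp at hu
    exact ⟨hsim.xi_eq hu0, hsim.eta_eq hu0⟩
  push Not at hone
  obtain ⟨i, j, hi, hj, hij⟩ := hone
  have hpar := hfix i j hi hj hij
  have htwo : ∀ k, σ k = k → k = i ∨ k = j := by
    intro k hk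
    by_contra h
    push Not at h
    have h1 := hfix k i hk hi h.1
    have h2 := hfix k j hk hj h.2
    simp only [Nat.ModEq] at hpar h1 h2
    lia
  have hcard : Even (Fintype.card ι) := by
    rw [even_card_iff_of_involutive hB.invol]
    have : (Finset.univ.filter fun k => σ k = k) = {i, j} := by
      ext k
      simp only [Finset.mem_filter, Finset.mem_univ, true_and, Finset.mem_insert,
        Finset.mem_singleton]
      exact ⟨htwo k, by rintro (rfl | rfl) <;> assumption⟩
    rw [this, Finset.card_pair hij]
    exact even_two
  obtain ⟨z, hz⟩ : ∃ z : ℕ, a i + a j = 2 * z + 1 := by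
    refine ⟨(a i + a j) / 2, ?_⟩
    simp only [Nat.ModEq] at hpar
    lia
  have hw : (weight a i * weight a j) ^ 2 = (1 / 4 : ℝ≥0) ^ (2 * (z : ℤ) + 1) := by
    rw [weight, weight, ← pow_add, hz, ← pow_mul, mul_comm, pow_mul,
      show ((1 / 2 : ℝ≥0)) ^ 2 = 1 / 4 by norm_num]
    exact_mod_cast rfl
  refine ⟨fun _ => ?_, fun h => absurd hcard h⟩
  rw [(hB.isEisensteinDisc h2 hij hi hj htwo hw).xi_eq_zero h2,
    ((hB.of_strictlyBounded_sub hD).isEisensteinDisc h2 hij hi hj htwo hw).xi_eq_zero h2]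

variable {n : ℕ} {a : Fin n → ℕ} {σ : Equiv.Perm (Fin n)} {B : Matrix (Fin n) (Fin n) F}

lemma IsReducedForm.invariants_block_eq [CharZero F] (hq : Even (Nat.card 𝓀[F]))
    (hB : IsReducedForm a σ B) (p : Fin n → Prop) [DecidablePred p]
    (hp : ∀ i j, p i → ¬ p j → a i < a j) {X : Matrix {i // p i} {i // p i} F}
    (hX : StrictlyBounded (fun i : {i // p i} => weight a i)
      (X - B.submatrix Subtype.val Subtype.val)) :
    (Even (Fintype.card {i // p i}) → xi X =
      xi (B.submatrix Subtype.val Subtype.val : Matrix {i // p i} {i // p i} F)) ∧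
    (¬ Even (Fintype.card {i // p i}) → eta X =
      eta (B.submatrix Subtype.val Subtype.val : Matrix {i // p i} {i // p i} F)) :=
  (hB.quasiReduced_block p hp).invariants_eq (a := fun i : {i // p i} => a i) hq hX
    (hB.not_modEq_of_truncate p hp)

/-- The invariants of the blocks of a reduced form `B` can be computed from any form `C` equivalent
to `B` with `a ∈ S(C)`: the change of basis induces one between the blocks, up to a strictly bounded
error. -/
lemma IsReducedForm.invariants_block_eq_of_mem_SSet [CharZero F] (hq : Even (Nat.card 𝓀[F]))
    (hB : IsReducedForm a σ B) {U C : Matrix (Fin n) (Fin n) F} (hU : ∀ i j, nrm F (U i j) ≤ 1)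
    (hU' : ∀ i j, nrm F (U⁻¹ i j) ≤ 1) (hdet : nrm F U.det = 1) (hC : C = U.transpose * B * U)
    (ha : a ∈ SSet C) (p : Fin n → Prop) [DecidablePred p] (hp : ∀ i j, p i → ¬ p j → a i < a j) :
    (Even (Fintype.card {i // p i}) →
      xi (C.submatrix Subtype.val Subtype.val : Matrix {i // p i} {i // p i} F) =
        xi (B.submatrix Subtype.val Subtype.val : Matrix {i // p i} {i // p i} F)) ∧
    (¬ Even (Fintype.card {i // p i}) →
      eta (C.submatrix Subtype.val Subtype.val : Matrix {i // p i} {i // p i} F) =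
        eta (B.submatrix Subtype.val Subtype.val : Matrix {i // p i} {i // p i} F)) := by
  have h2 := nrm_two_lt_one hq
  have hdet0 : IsUnit U.det := by
    rw [isUnit_iff_ne_zero]; rintro h; rw [h] at hdet; simp at hdet
  obtain ⟨hC1, hC2⟩ := nrm_le_of_mem_SSet ha
  have hsymm : C.IsSymm := by
    rw [hC, Matrix.IsSymm, Matrix.transpose_mul, Matrix.transpose_mul, Matrix.transpose_transpose,
      hB.quasiReduced.symm.eq, Matrix.mul_assoc]
  have hBC : U⁻¹.transpose * C * U⁻¹ = B := by
    rw [hC, Matrix.mul_assoc, Matrix.mul_assoc, Matrix.mul_nonsing_inv _ hdet0, Matrix.mul_one,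
      ← Matrix.mul_assoc, ← Matrix.transpose_mul, Matrix.mul_nonsing_inv _ hdet0,
      Matrix.transpose_one, Matrix.one_mul]
  have hS := WeaklyBounded.strictlyBounded_block (weight_pos a) ⟨hsymm, hC1, hC2⟩ hU'
    (fun i j => hB.nrm_inv_le h2 hU hU' hdet hC ha j i) p fun i j hi hj =>
      half_pow_lt.2 (hp i j hi hj)
  rw [hBC] at hS
  set W : Matrix {i // p i} {i // p i} F := U⁻¹.submatrix Subtype.val Subtype.val
  set X : Matrix {i // p i} {i // p i} F := C.submatrix Subtype.val Subtype.val
  have hne : (W.transpose * X * W).det ≠ 0 :=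
    ((hB.quasiReduced_block p hp).of_strictlyBounded_sub hS).det_ne_zero h2
      fun _ _ hi hj hij _ _ hx => nrm_mul_weight_ne (a := fun i : {i // p i} => a i)
        (hB.not_modEq_of_truncate p hp _ _ hi hj hij) hx
  rw [Matrix.det_mul] at hne
  have hsim : IsSimilar 1 X (W.transpose * X * W) := ⟨W, right_ne_zero_of_mul hne, by rw [one_smul]⟩
  have h := hB.invariants_block_eq hq p hp hS
  exact ⟨fun he => (hsim.xi_eq one_ne_zero he).symm.trans (h.1 he),
    fun ho => (hsim.eta_eq one_ne_zero ho).symm.trans (h.2 ho)⟩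

end Invariants

/-! ### The extended GK datum of a reduced form -/

section Datum

lemma partialSum_eq_card {n : ℕ} (a : Fin n → ℕ) (s : Fin (Finset.univ.image a).card) :
    partialSum a s = (Finset.univ.filter fun i => a i ≤ value a s).card := by
  rw [Finset.card_eq_sum_card_fiberwise (f := a) (t := (Finset.Iic s).image (value a))]
  · have hinj : Function.Injective (value a) := (Finset.orderEmbOfFin _ rfl).injective
    rw [Finset.sum_image hinj.injOn, partialSum]
    refine Finset.sum_congr rfl fun u hu => ?_
    rw [multiplicity, Finset.filter_filter]
    congr 1
    ext i
    simp only [Finset.mem_filter, Finset.mem_univ, true_and]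
    refine ⟨fun h => ⟨h.le.trans ?_, h⟩, fun h => h.2⟩
    exact (Finset.orderEmbOfFin _ rfl).monotone (Finset.mem_Iic.1 hu)
  · intro i hi
    have hi' : a i ≤ value a s := by simpa using hi
    have : a i ∈ Set.range (Finset.orderEmbOfFin (Finset.univ.image a) rfl) := by
      rw [Finset.range_orderEmbOfFin]; simp
    obtain ⟨u, hu⟩ := this
    simp only [Finset.coe_image, Set.mem_image]
    refine ⟨u, ?_, hu⟩
    rw [Finset.coe_Iic, Set.mem_Iic,
      ← (Finset.orderEmbOfFin (Finset.univ.image a) rfl).le_iff_le, hu]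
    exact hi'

/-- The indices below `n_s^*` are those with `a i ≤ m_s`. -/
lemma lt_partialSum_iff {n : ℕ} {a : Fin n → ℕ} (ha : Monotone a)
    (s : Fin (Finset.univ.image a).card) (i : Fin n) :
    (i : ℕ) < partialSum a s ↔ a i ≤ value a s := by
  rw [partialSum_eq_card]
  constructor
  · intro h
    by_contra hcon
    rw [not_le] at hcon
    refine absurd h (not_lt.2 ?_)
    calc _ ≤ (Finset.Iio i).card := Finset.card_le_card fun j hj => by
          rw [Finset.mem_Iio]
          by_contra hji
          exact absurd ((Finset.mem_filter.1 hj).2) (not_le.2 (hcon.trans_le (ha (not_lt.1 hji))))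
      _ = i := Fin.card_Iio i
  · intro h
    calc (i : ℕ) < (Finset.Iic i).card := by rw [Fin.card_Iic]; exact Nat.lt_succ_self _
      _ ≤ _ := Finset.card_le_card fun j hj => Finset.mem_filter.2
        ⟨Finset.mem_univ _, (ha (Finset.mem_Iic.1 hj)).trans h⟩

lemma card_lt_partialSum {n : ℕ} {a : Fin n → ℕ} (ha : Monotone a)
    (s : Fin (Finset.univ.image a).card) :
    Fintype.card {i : Fin n // (i : ℕ) < partialSum a s} = partialSum a s := by
  rw [Fintype.card_subtype]
  conv_rhs => rw [partialSum_eq_card]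
  simp only [lt_partialSum_iff ha]

variable {F : Type*} [Field F] [ValuativeRel F] {n : ℕ} {a : Fin n → ℕ}
  {B : Matrix (Fin n) (Fin n) F}

/-- The datum of `C` depends only on the invariants of the blocks on sets of indices that are closed
downwards with respect to `a`. -/
lemma datumOf_eq {C : Matrix (Fin n) (Fin n) F} (ha : Monotone a)
    (h : ∀ (p : Fin n → Prop) [DecidablePred p], (∀ i j, p i → ¬ p j → a i < a j) →
      (Even (Fintype.card {i // p i}) →
        xi (C.submatrix Subtype.val Subtype.val : Matrix {i // p i} {i // p i} F) =
          xi (B.submatrix Subtype.val Subtype.val : Matrix {i // p i} {i // p i} F)) ∧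
      (¬ Even (Fintype.card {i // p i}) →
        eta (C.submatrix Subtype.val Subtype.val : Matrix {i // p i} {i // p i} F) =
          eta (B.submatrix Subtype.val Subtype.val : Matrix {i // p i} {i // p i} F))) :
    datumOf a C = datumOf a B := by
  rw [datumOf, datumOf, Datum.mk.injEq]
  refine ⟨rfl, HEq.rfl, HEq.rfl, heq_of_eq (funext fun s => ?_)⟩
  have hs := h (fun i : Fin n => (i : ℕ) < partialSum a s) fun i j hi hj => by
    rw [lt_partialSum_iff ha] at hi hj
    exact hi.trans_lt (not_le.1 hj)
  rw [card_lt_partialSum ha] at hs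
  by_cases he : Even (partialSum a s)
  · rw [if_pos he, if_pos he]; exact hs.1 he
  · rw [if_neg he, if_neg he]; exact hs.2 he

lemma IsEquivalent.refl (B : Matrix (Fin n) (Fin n) F) : IsEquivalent B B :=
  ⟨1, by simp⟩

lemma IsEquivalent.trans {A B C : Matrix (Fin n) (Fin n) F} (h : IsEquivalent A B)
    (h' : IsEquivalent B C) : IsEquivalent A C := by
  obtain ⟨U, rfl⟩ := h
  obtain ⟨V, rfl⟩ := h'
  refine ⟨U * V, ?_⟩
  simp only [Units.val_mul, Matrix.map_mul, Matrix.transpose_mul, Matrix.mul_assoc]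

lemma map_mul_map_inv (U : GL (Fin n) 𝒪[F]) :
    (U : Matrix (Fin n) (Fin n) 𝒪[F]).map (algebraMap 𝒪[F] F) *
      ((U⁻¹ : GL (Fin n) 𝒪[F]) : Matrix (Fin n) (Fin n) 𝒪[F]).map (algebraMap 𝒪[F] F) = 1 := by
  rw [← Matrix.map_mul, ← Units.val_mul, mul_inv_cancel, Units.val_one]
  simp

lemma IsEquivalent.symm {B C : Matrix (Fin n) (Fin n) F} (h : IsEquivalent B C) :
    IsEquivalent C B := by
  obtain ⟨U, rfl⟩ := h
  refine ⟨U⁻¹, ?_⟩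
  have h1 := map_mul_map_inv U
  set V := (U : Matrix (Fin n) (Fin n) 𝒪[F]).map (algebraMap 𝒪[F] F)
  rw [Matrix.mul_assoc, Matrix.mul_assoc, h1, Matrix.mul_one, ← Matrix.mul_assoc,
    ← Matrix.transpose_mul, h1, Matrix.transpose_one, Matrix.one_mul]

variable [TopologicalSpace F] [IsNonarchimedeanLocalField F] {σ : Equiv.Perm (Fin n)}

lemma IsEquivalent.SClassSet_eq {B C : Matrix (Fin n) (Fin n) F} (h : IsEquivalent B C) :
    SClassSet B = SClassSet C := by
  ext a
  exact ⟨fun ⟨X, h1, h2⟩ => ⟨X, h.symm.trans h1, h2⟩, fun ⟨X, h1, h2⟩ => ⟨X, h.trans h1, h2⟩⟩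

lemma IsEquivalent.exists_matrix {B C : Matrix (Fin n) (Fin n) F} (h : IsEquivalent B C) :
    ∃ U : Matrix (Fin n) (Fin n) F, (∀ i j, nrm F (U i j) ≤ 1) ∧ (∀ i j, nrm F (U⁻¹ i j) ≤ 1) ∧
      nrm F U.det = 1 ∧ C = U.transpose * B * U := by
  obtain ⟨U, hU⟩ := h
  refine ⟨(U : Matrix (Fin n) (Fin n) 𝒪[F]).map (algebraMap 𝒪[F] F),
    fun i j => nrm_integer_le _, fun i j => ?_, ?_, hU⟩
  · rw [Matrix.inv_eq_right_inv (map_mul_map_inv U)]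
    exact nrm_integer_le _
  · have h1 : IsUnit (U : Matrix (Fin n) (Fin n) 𝒪[F]).det :=
      (Matrix.isUnit_iff_isUnit_det _).1 U.isUnit
    have h2 := (algebraMap 𝒪[F] F).map_det (U : Matrix (Fin n) (Fin n) 𝒪[F])
    rw [RingHom.mapMatrix_apply] at h2
    rw [← h2]
    exact (isUnit_integer_iff _).1 h1

lemma HasGK.unique {a a' : Fin n → ℕ} (h : HasGK B a) (h' : HasGK B a') : a = a' :=
  toLex.injective (le_antisymm (h'.2.2.2 a h.2.2.1) (h.2.2.2 a' h'.2.2.1))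

lemma IsReducedForm.hasGK (hB : IsReducedForm a σ B) (h2 : nrm F 2 < 1) : HasGK B a := by
  refine ⟨hB.mem.1, hB.det_ne_zero h2, ⟨B, .refl B, hB.mem_SSet h2⟩, ?_⟩
  rintro a' ⟨C, hBC, ha'⟩
  obtain ⟨U, hU, hU', hdet, hC⟩ := hBC.exists_matrix
  exact hB.toLex_le h2 hU hU' hdet hC ha'

lemma IsReducedForm.EGKSet_eq [CharZero F] (hq : Even (Nat.card 𝓀[F]))
    (hB : IsReducedForm a σ B) : EGKSet B = {datumOf a B} := by
  have h2 := nrm_two_lt_one hq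
  have hGK := hB.hasGK h2
  refine Set.Subset.antisymm ?_ ?_
  · rintro G ⟨a', C, h1, hBC, ⟨a'', h3, h4⟩, rfl⟩
    have e : a' = a := h1.unique hGK
    have e' : a'' = a := by
      refine toLex.injective (le_antisymm (hGK.2.2.2 _ ?_) (h3.2.2.2 _ ?_))
      · rw [hBC.SClassSet_eq]; exact h3.2.2.1
      · rw [← hBC.SClassSet_eq]; exact hGK.2.2.1
    subst e e'
    obtain ⟨U, hU, hU', hdet, hC⟩ := hBC.exists_matrix
    exact datumOf_eq hB.monotone fun p _ hp =>
      hB.invariants_block_eq_of_mem_SSet hq hU hU' hdet hC h4 p hp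
  · rintro G rfl
    exact ⟨a, B, hGK, .refl B, ⟨a, hGK, hB.mem_SSet h2⟩, rfl⟩

lemma IsReducedForm.datumOf_eq_of_sub_mem [CharZero F] (hq : Even (Nat.card 𝓀[F]))
    (hB : IsReducedForm a σ B) {B' : Matrix (Fin n) (Fin n) F} (hD : B' - B ∈ MZeroSet a) :
    datumOf a B' = datumOf a B :=
  datumOf_eq hB.monotone fun p _ hp => hB.invariants_block_eq hq p hp
    ((strictlyBounded_of_mem hD).submatrix _ Subtype.val_injective)

end Datum

end

end GrossKeating

theorem theorem3p3 {F : Type*} [Field F] [CharZero F] [ValuativeRel F] [TopologicalSpace F]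
    [IsNonarchimedeanLocalField F] (hq : Even (Nat.card 𝓀[F]))
    {n : ℕ} (a : Fin n → ℕ) (σ : Equiv.Perm (Fin n)) (B B' : Matrix (Fin n) (Fin n) F)
    (hB : GrossKeating.IsHalfIntegral B) (hB' : GrossKeating.IsHalfIntegral B')
    (hred : GrossKeating.IsReducedForm a σ B) (hdiff : B' - B ∈ GrossKeating.MZeroSet a) :
    GrossKeating.IsReducedForm a σ B' ∧
      ∃ G : GrossKeating.Datum, GrossKeating.EGKSet B = {G} ∧ GrossKeating.EGKSet B' = {G} := by
  have hred' := hred.of_sub_mem hB' hdiff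
  refine ⟨hred', GrossKeating.datumOf a B, hred.EGKSet_eq hq, ?_⟩
  rw [hred'.EGKSet_eq hq, hred.datumOf_eq_of_sub_mem hq hdiff]
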